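/- Let $V$ be a complex Banach space, and let $T(V)=\ell^1\text{-}\bigoplus_{k\ge 0}V^{\hat\otimes k}$ be its tensor algebra: the $\ell^1$-direct sum of the completed projective tensor powers of $V$ (with $V^{\hat\otimes 0}=\mathbb{C}$), a unital Banach algebra under the product given by concatenation of elementary tensors. For a Banach algebra $A$ and $n\ge 0$ let $C^n(A)$ be the space of bounded $(n+1)$-linear functionals $T:A^{n+1}\to\mathbb{C}$, with coboundary $\delta:C^n(A)\to C^{n+1}(A)$, $$(\delta T)(a_1,\dots,a_{n+2})=T(a_2,\dots,a_{n+1},a_{n+2}a_1)+\sum_{j=1}^{n+1}(-1)^jT(a_1,\dots,a_ja_{j+1},\dots,a_{n+2}).$$ Call $T\in C^n(A)$ cyclic if $(-1)^nT(a_{n+1},a_1,\dots,a_n)=T(a_1,\dots,a_{n+1})$ for all $a_i \in A$. The cyclic cohomology group $\mathcal{HC}^n(A)$ is the space of cyclic $n$-cochains $T$ with $\delta T=0$ modulo the space of those of the form $\delta S$ with $S$ a cyclic $(n-1)$-cochain (modulo $0$ if $n=0$), with the quotient topology of the operator norm. Then $\mathcal{HC}^n(T(V))=0$ for every odd $n$,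 and $\mathcal{HC}^n(T(V))\cong\mathbb{C}$ (as topological vector spaces) for every even $n\ge 2$. Moreover, for every $m\ge 0$, if $\mathbb{F}_m$ denotes the free semigroup with identity on generators $p_1,\dots,p_m$ and $\ell^1(\mathbb{F}_m)$ its convolution algebra, there is an isometric isomorphism of unital algebras $T(\ell^1_m)\to\ell^1(\mathbb{F}_m)$ that sends the basis vector $e_j$ to $p_j$ for $1\le j\le m$; hence also $\mathcal{HC}^n(\ell^1(\mathbb{F}_m))=0$ for every odd $n$ and $\mathcal{HC}^n(\ell^1(\mathbb{F}_m))\cong\mathbb{C}$ for every even $n\ge 2$. -/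

import Mathlib

open scoped TensorProduct ENNReal

set_option linter.unusedSectionVars false
set_option linter.unusedSimpArgs false

noncomputable section

/-! ### Cyclic cohomology of a Banach algebra -/

section CyclicCohomology

variable (A : Type*) [NormedRing A] [NormedAlgebra ℂ A]

/-- The space of simplicial `n`-cochains of `A`: bounded `(n+1)`-linear functionals on `A`.
A bounded `n`-linear map `T : Aⁿ → A'` is identified with the functional
`(a₀, …, aₙ) ↦ T (a₀, …, aₙ₋₁) (aₙ)`. -/
def SimplicialCochain (n : ℕ) : Type _ :=
  ContinuousMultilinearMap ℂ (fun _ : Fin (n + 1) => A) ℂ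

namespace SimplicialCochain

variable {A} {n : ℕ}

instance : NormedAddCommGroup (SimplicialCochain A n) :=
  inferInstanceAs (NormedAddCommGroup (ContinuousMultilinearMap ℂ (fun _ : Fin (n + 1) => A) ℂ))

instance : NormedSpace ℂ (SimplicialCochain A n) :=
  inferInstanceAs (NormedSpace ℂ (ContinuousMultilinearMap ℂ (fun _ : Fin (n + 1) => A) ℂ))

instance : FunLike (SimplicialCochain A n) (Fin (n + 1) → A) ℂ :=
  inferInstanceAs
    (FunLike (ContinuousMultilinearMap ℂ (fun _ : Fin (n + 1) => A) ℂ) (Fin (n + 1) → A) ℂ)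

/-- A cochain as a continuous multilinear map. -/
def toMap (T : SimplicialCochain A n) : ContinuousMultilinearMap ℂ (fun _ : Fin (n + 1) => A) ℂ :=
  T

@[simp] lemma toMap_apply (T : SimplicialCochain A n) (a : Fin (n + 1) → A) : T.toMap a = T a := rfl

@[ext] lemma ext {S T : SimplicialCochain A n} (h : ∀ a, S a = T a) : S = T := DFunLike.ext _ _ h

@[simp] lemma add_apply (S T : SimplicialCochain A n) (a : Fin (n + 1) → A) :
    (S + T) a = S a + T a := rfl

@[simp] lemma smul_apply (c : ℂ) (T : SimplicialCochain A n) (a : Fin (n + 1) → A) :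
    (c • T) a = c * T a := rfl

@[simp] lemma zero_apply (a : Fin (n + 1) → A) : (0 : SimplicialCochain A n) a = 0 := rfl

@[simp] lemma sum_apply {ι : Type*} (s : Finset ι) (f : ι → SimplicialCochain A n)
    (a : Fin (n + 1) → A) : (∑ i ∈ s, f i) a = ∑ i ∈ s, f i a :=
  _root_.sum_apply (F := ContinuousMultilinearMap ℂ (fun _ : Fin (n + 1) => A) ℂ) s f a

end SimplicialCochain

variable {A}

/-- The tuple `(a₁, …, aₙ, aₙ₊₁ a₀)` formed from `(a₀, …, aₙ₊₁)`. -/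
def wrapFace {n : ℕ} (a : Fin (n + 2) → A) : Fin (n + 1) → A :=
  Fin.snoc (α := fun _ => A) (fun i : Fin n => a i.succ.castSucc) (a (Fin.last (n + 1)) * a 0)

/-- The tuple `(a₀, …, aⱼ aⱼ₊₁, …, aₙ₊₁)` formed from `(a₀, …, aₙ₊₁)`, for `0 ≤ j ≤ n`. -/
def mergeFace {n : ℕ} (j : Fin (n + 1)) (a : Fin (n + 2) → A) : Fin (n + 1) → A :=
  Fin.contractNth j.castSucc (· * ·) a

/-- Changing one entry of a tuple changes one entry of its face, in a linear way. -/
lemma mergeFace_update {n : ℕ} (j : Fin (n + 1)) (a : Fin (n + 2) → A) (i : Fin (n + 2)) :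
    ∃ (k : Fin (n + 1)) (L : A →ₗ[ℂ] A),
      ∀ x, mergeFace j (Function.update a i x) = Function.update (mergeFace j a) k (L x) := by
  rcases lt_trichotomy (i : ℕ) (j : ℕ) with h | h | h
  · refine ⟨⟨i, by omega⟩, LinearMap.id, fun x => funext fun l => ?_⟩
    simp only [mergeFace, Fin.contractNth, Function.update_apply, Fin.ext_iff, LinearMap.id_apply,
      LinearMap.mulLeft_apply, LinearMap.mulRight_apply, Fin.val_castSucc, Fin.val_succ]
    grind
  · refine ⟨j, LinearMap.mulRight ℂ (a j.succ), fun x => funext fun l => ?_⟩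
    simp only [mergeFace, Fin.contractNth, Function.update_apply, Fin.ext_iff, LinearMap.id_apply,
      LinearMap.mulLeft_apply, LinearMap.mulRight_apply, Fin.val_castSucc, Fin.val_succ]
    grind
  · by_cases h' : (i : ℕ) = j + 1
    · refine ⟨j, LinearMap.mulLeft ℂ (a j.castSucc), fun x => funext fun l => ?_⟩
      simp only [mergeFace, Fin.contractNth, Function.update_apply, Fin.ext_iff, LinearMap.id_apply,
      LinearMap.mulLeft_apply, LinearMap.mulRight_apply, Fin.val_castSucc, Fin.val_succ]
      grind
    · refine ⟨⟨i - 1, by omega⟩, LinearMap.id, fun x => funext fun l => ?_⟩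
      simp only [mergeFace, Fin.contractNth, Function.update_apply, Fin.ext_iff, LinearMap.id_apply,
      LinearMap.mulLeft_apply, LinearMap.mulRight_apply, Fin.val_castSucc, Fin.val_succ]
      grind

lemma wrapFace_update {n : ℕ} (a : Fin (n + 2) → A) (i : Fin (n + 2)) :
    ∃ (k : Fin (n + 1)) (L : A →ₗ[ℂ] A),
      ∀ x, wrapFace (Function.update a i x) = Function.update (wrapFace a) k (L x) := by
  by_cases h0 : (i : ℕ) = 0
  · refine ⟨Fin.last n, LinearMap.mulLeft ℂ (a (Fin.last _)), fun x => funext fun l => ?_⟩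
    refine Fin.lastCases ?_ (fun l => ?_) l
    all_goals simp [wrapFace, Function.update_apply, Fin.ext_iff]; try grind
  by_cases h1 : (i : ℕ) = n + 1
  · refine ⟨Fin.last n, LinearMap.mulRight ℂ (a 0), fun x => funext fun l => ?_⟩
    refine Fin.lastCases ?_ (fun l => ?_) l
    all_goals simp [wrapFace, Function.update_apply, Fin.ext_iff]; try grind
  · refine ⟨⟨i - 1, by omega⟩, LinearMap.id, fun x => funext fun l => ?_⟩
    refine Fin.lastCases ?_ (fun l => ?_) l
    all_goals simp [wrapFace, Function.update_apply, Fin.ext_iff]; try grind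

lemma continuous_mergeFace {n : ℕ} (j : Fin (n + 1)) :
    Continuous (mergeFace (A := A) j) := by
  refine continuous_pi fun k => ?_
  unfold mergeFace Fin.contractNth
  split_ifs <;> fun_prop

lemma continuous_wrapFace {n : ℕ} : Continuous (wrapFace (A := A) (n := n)) := by
  refine continuous_pi fun k => ?_
  refine Fin.lastCases ?_ (fun l => ?_) k
  · simp only [wrapFace, Fin.snoc_last]
    fun_prop
  · simp only [wrapFace, Fin.snoc_castSucc]
    fun_prop

/-- Precomposition of a cochain with a face operation. -/
def SimplicialCochain.compFace {n : ℕ} (T : SimplicialCochain A n)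
    (d : (Fin (n + 2) → A) → Fin (n + 1) → A)
    (hd : ∀ a i, ∃ (k : Fin (n + 1)) (L : A →ₗ[ℂ] A),
      ∀ x, d (Function.update a i x) = Function.update (d a) k (L x))
    (hc : Continuous d) : SimplicialCochain A (n + 1) :=
  { toFun := fun a => T.toMap (d a)
    map_update_add' := fun {inst} a i x y => by
      obtain rfl : inst = instDecidableEqFin _ := Subsingleton.elim _ _
      obtain ⟨k, L, h⟩ := hd a i
      simp only [h, map_add, ContinuousMultilinearMap.map_update_add]
    map_update_smul' := fun {inst} a i c x => by
      obtain rfl : inst = instDecidableEqFin _ := Subsingleton.elim _ _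
      obtain ⟨k, L, h⟩ := hd a i
      simp only [h, map_smul, ContinuousMultilinearMap.map_update_smul]
    cont := T.toMap.cont.comp hc : ContinuousMultilinearMap ℂ (fun _ : Fin (n + 2) => A) ℂ }

@[simp]
lemma SimplicialCochain.compFace_apply {n : ℕ} (T : SimplicialCochain A n)
    (d : (Fin (n + 2) → A) → Fin (n + 1) → A) (hd) (hc) (a : Fin (n + 2) → A) :
    T.compFace d hd hc a = T (d a) := rfl

variable (A)

/-- The Hochschild coboundary operator on simplicial cochains; see
`hochschildCoboundary_apply`. -/
def hochschildCoboundary (n : ℕ) : SimplicialCochain A n →ₗ[ℂ] SimplicialCochain A (n + 1) where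
  toFun T := T.compFace wrapFace wrapFace_update continuous_wrapFace +
    ∑ j : Fin (n + 1), (-1 : ℂ) ^ ((j : ℕ) + 1) •
      T.compFace (mergeFace j) (mergeFace_update j) (continuous_mergeFace j)
  map_add' S T := by
    ext a
    simp [mul_add, Finset.sum_add_distrib]
    abel
  map_smul' c T := by
    ext a
    simp [mul_add, Finset.mul_sum, mul_left_comm]

variable {A}

/-- `(δT)(a₀, …, aₙ₊₁) = T(a₁, …, aₙ, aₙ₊₁ a₀) + ∑ⱼ (-1)^(j+1) T(a₀, …, aⱼ aⱼ₊₁, …, aₙ₊₁)`,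
the sum being over `0 ≤ j ≤ n`. -/
lemma hochschildCoboundary_apply {n : ℕ} (T : SimplicialCochain A n) (a : Fin (n + 2) → A) :
    hochschildCoboundary A n T a =
      T (wrapFace a) + ∑ j : Fin (n + 1), (-1 : ℂ) ^ ((j : ℕ) + 1) * T (mergeFace j a) := by
  simp [hochschildCoboundary]

variable (A)

/-- The space of cyclic `n`-cochains: those `T` with
`(-1)ⁿ T(aₙ, a₀, …, aₙ₋₁) = T(a₀, …, aₙ)`. -/
def cyclicCochains (n : ℕ) : Submodule ℂ (SimplicialCochain A n) where
  carrier := {T | ∀ a : Fin (n + 1) → A,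
    (-1 : ℂ) ^ n * T (Fin.cons (α := fun _ => A) (a (Fin.last n)) (Fin.init a)) = T a}
  add_mem' {S T} hS hT a := by simp [mul_add, hS a, hT a]
  zero_mem' a := by simp
  smul_mem' c T hT a := by simp [← hT a, mul_left_comm]

/-- The space of cyclic `n`-cocycles. -/
def cyclicCocycles (n : ℕ) : Submodule ℂ (SimplicialCochain A n) :=
  cyclicCochains A n ⊓ (hochschildCoboundary A n).ker

/-- The space of cyclic `n`-coboundaries: the coboundaries of cyclic `(n-1)`-cochains
(and `0` for `n = 0`). -/
def cyclicCoboundaries : (n : ℕ) → Submodule ℂ (SimplicialCochain A n)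
  | 0 => ⊥
  | n + 1 => (cyclicCochains A n).map (hochschildCoboundary A n)

/-- The `n`-th cyclic cohomology group: cyclic cocycles modulo cyclic coboundaries, with the
quotient topology. -/
abbrev CyclicCohomology (n : ℕ) : Type _ :=
  cyclicCocycles A n ⧸ (cyclicCoboundaries A n).submoduleOf (cyclicCocycles A n)

end CyclicCohomology

/-! ### Products on `ℓ¹`-direct sums -/

section L1

universe u v

/-- Data for an associative unital product on the `ℓ¹`-direct sum of Banach spaces `E i`: a monoid
structure on the indices (in unbundled form) and contractive bilinear maps
`E i × E j → E (i · j)`, associative and unital when compared inside the direct sum. -/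
structure L1Product {ι : Type u} [DecidableEq ι] (E : ι → Type v) [∀ i, NormedAddCommGroup (E i)]
    [∀ i, NormedSpace ℂ (E i)] where
  op : ι → ι → ι
  unit : ι
  one : E unit
  mul : ∀ i j, E i →L[ℂ] E j →L[ℂ] E (op i j)
  norm_mul_le : ∀ i j (x : E i) (y : E j), ‖mul i j x y‖ ≤ ‖x‖ * ‖y‖
  mul_assoc : ∀ i j k (x : E i) (y : E j) (z : E k),
    lp.single (E := E) 1 _ (mul _ _ (mul _ _ x y) z) = lp.single 1 _ (mul _ _ x (mul _ _ y z))
  one_mul : ∀ i (x : E i), lp.single (E := E) 1 _ (mul _ _ one x) = lp.single 1 i x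
  mul_one : ∀ i (x : E i), lp.single (E := E) 1 _ (mul _ _ x one) = lp.single 1 i x

namespace L1Product

variable {ι : Type u} {E : ι → Type v} [∀ i, NormedAddCommGroup (E i)]

lemma hasSum_norm (x : lp E 1) : HasSum (fun i => ‖x i‖) ‖x‖ := by
  simpa using lp.hasSum_norm (p := 1) (by simp) x

lemma hasSum_prod_norm (x y : lp E 1) :
    HasSum (fun p : ι × ι => ‖x p.1‖ * ‖y p.2‖) (‖x‖ * ‖y‖) :=
  (hasSum_norm x).mul (hasSum_norm y) ((hasSum_norm x).summable.mul_of_nonneg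
    (hasSum_norm y).summable (fun _ => norm_nonneg _) (fun _ => norm_nonneg _))

variable [DecidableEq ι] [∀ i, NormedSpace ℂ (E i)] (D : L1Product E)

/-- The product `∑ᵢⱼ xᵢ yⱼ` of `x = ∑ᵢ xᵢ` and `y = ∑ⱼ yⱼ`. -/
def mulFun (x y : lp E 1) : lp E 1 :=
  ∑' p : ι × ι, lp.single 1 (D.op p.1 p.2) (D.mul p.1 p.2 (x p.1) (y p.2))

lemma norm_term_le (x y : lp E 1) (p : ι × ι) :
    ‖(lp.single 1 (D.op p.1 p.2) (D.mul p.1 p.2 (x p.1) (y p.2)) : lp E 1)‖ ≤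
      ‖x p.1‖ * ‖y p.2‖ := by
  rw [lp.norm_single (by simp)]
  exact D.norm_mul_le _ _ _ _

variable [∀ i, CompleteSpace (E i)]

lemma summable_term (x y : lp E 1) : Summable fun p : ι × ι =>
    (lp.single 1 (D.op p.1 p.2) (D.mul p.1 p.2 (x p.1) (y p.2)) : lp E 1) :=
  Summable.of_norm_bounded (hasSum_prod_norm x y).summable (D.norm_term_le x y)

lemma norm_mulFun_le (x y : lp E 1) : ‖D.mulFun x y‖ ≤ ‖x‖ * ‖y‖ :=
  tsum_of_norm_bounded (hasSum_prod_norm x y) (D.norm_term_le x y)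

/-- The product as a bounded bilinear map. -/
def mulL : lp E 1 →L[ℂ] lp E 1 →L[ℂ] lp E 1 :=
  LinearMap.mkContinuous₂
    (LinearMap.mk₂ ℂ D.mulFun
      (fun x x' y => by
        rw [mulFun, mulFun, mulFun, ← (D.summable_term x y).tsum_add (D.summable_term x' y)]
        simp)
      (fun c x y => by
        rw [mulFun, mulFun, ← (D.summable_term x y).tsum_const_smul c]
        simp)
      (fun x y y' => by
        rw [mulFun, mulFun, mulFun, ← (D.summable_term x y).tsum_add (D.summable_term x y')]
        simp)
      (fun c x y => by
        rw [mulFun, mulFun, ← (D.summable_term x y).tsum_const_smul c]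
        simp)) 1
    (fun x y => by simpa using D.norm_mulFun_le x y)

lemma mulL_single (i j : ι) (x : E i) (y : E j) :
    D.mulL (lp.single 1 i x) (lp.single 1 j y) = lp.single 1 (D.op i j) (D.mul i j x y) := by
  change D.mulFun _ _ = _
  rw [mulFun, tsum_eq_single (i, j)]
  · simp
  · rintro ⟨k, l⟩ h
    by_cases hk : k = i
    · subst hk
      have hl : l ≠ j := fun hl => h (by rw [hl])
      simp [Pi.single_eq_of_ne hl]
    · simp [Pi.single_eq_of_ne hk]

lemma ext_single {F : Type*} [NormedAddCommGroup F] [NormedSpace ℂ F] (f g : lp E 1 →L[ℂ] F)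
    (h : ∀ i (x : E i), f (lp.single 1 i x) = g (lp.single 1 i x)) (x : lp E 1) : f x = g x := by
  have : f = g := lp.ext_continuousLinearMap (by simp) fun i => by
    ext x
    exact h i x
  rw [this]

lemma mulL_assoc (x y z : lp E 1) : D.mulL (D.mulL x y) z = D.mulL x (D.mulL y z) := by
  refine ext_single (D.mulL.flip z ∘L D.mulL.flip y) (D.mulL.flip (D.mulL y z)) (fun i x => ?_) x
  refine ext_single (D.mulL.flip z ∘L D.mulL (lp.single 1 i x))
    (D.mulL (lp.single 1 i x) ∘L D.mulL.flip z) (fun j y => ?_) y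
  refine ext_single (D.mulL (D.mulL (lp.single 1 i x) (lp.single 1 j y)))
    (D.mulL (lp.single 1 i x) ∘L D.mulL (lp.single 1 j y)) (fun k z => ?_) z
  simp only [ContinuousLinearMap.comp_apply, mulL_single]
  exact D.mul_assoc _ _ _ _ _ _

/-- The Banach algebra structure on the `ℓ¹`-direct sum. -/
abbrev normedRing : NormedRing (lp E 1) where
  __ := (inferInstance : NormedAddCommGroup (lp E 1))
  mul x y := D.mulFun x y
  one := lp.single 1 D.unit D.one
  mul_assoc := D.mulL_assoc
  one_mul x := ext_single (D.mulL (lp.single 1 D.unit D.one)) (.id ℂ _)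
    (fun i x => by rw [mulL_single]; exact D.one_mul i x) x
  mul_one x := ext_single (D.mulL.flip (lp.single 1 D.unit D.one)) (.id ℂ _)
    (fun i x => by rw [ContinuousLinearMap.flip_apply, mulL_single]; exact D.mul_one i x) x
  left_distrib x y z := map_add (D.mulL x) y z
  right_distrib x y z := by
    change D.mulL (x + y) z = D.mulL x z + D.mulL y z
    simp
  zero_mul x := by
    change D.mulL 0 x = 0
    simp
  mul_zero x := map_zero (D.mulL x)
  norm_mul_le := D.norm_mulFun_le

/-- The scalar multiplication makes the `ℓ¹`-direct sum a Banach algebra. -/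
abbrev normedAlgebra : @NormedAlgebra ℂ (lp E 1) _ D.normedRing.toSeminormedRing :=
  letI := D.normedRing
  { Algebra.ofModule (R := ℂ) (A := lp E 1)
      (fun c x y => by
        change D.mulL (c • x) y = c • D.mulL x y
        simp)
      (fun c x y => map_smul (D.mulL x) c y) with
    norm_smul_le := fun c x => norm_smul_le c x }

end L1Product

end L1

/-! ### The `ℓ¹`-algebra of a monoid -/

section Semigroup

variable (S : Type*) [Monoid S] [DecidableEq S]

/-- The Banach space `ℓ¹(S)`. -/
abbrev L1Algebra (S : Type*) : Type _ := lp (fun _ : S => ℂ) 1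

/-- The convolution product on `ℓ¹(S)`: `δ_s * δ_t = δ_{st}`. -/
def L1Algebra.product : L1Product (fun _ : S => ℂ) where
  op := (· * ·)
  unit := 1
  one := 1
  mul _ _ := ContinuousLinearMap.mul ℂ ℂ
  norm_mul_le _ _ x y := (norm_mul x y).le
  mul_assoc i j k x y z := by simp only [ContinuousLinearMap.mul_apply', _root_.mul_assoc]
  one_mul i x := by simp
  mul_one i x := by simp

instance : NormedRing (L1Algebra S) := (L1Algebra.product S).normedRing

instance : NormedAlgebra ℂ (L1Algebra S) := (L1Algebra.product S).normedAlgebra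

lemma L1Algebra.single_mul_single (s t : S) (c d : ℂ) :
    (lp.single 1 s c * lp.single 1 t d : L1Algebra S) = lp.single 1 (s * t) (c * d) :=
  (L1Algebra.product S).mulL_single s t c d

instance {α : Type*} [DecidableEq α] : DecidableEq (FreeMonoid α) :=
  inferInstanceAs (DecidableEq (List α))

end Semigroup

/-! ### The tensor algebra of a Banach space -/

section TensorAlgebra

variable (V : Type*) [NormedAddCommGroup V] [NormedSpace ℂ V]

/-- The `k`-fold completed projective tensor power of `V`: the completion of the algebraic tensor
power for the projective norm (which is the norm that `⨂[ℂ]^k V` carries). For `k = 0` this is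
a copy of `ℂ`. -/
abbrev ProjTensorPower (k : ℕ) : Type _ := UniformSpace.Completion (⨂[ℂ]^k V)

variable {V}

/-- The elementary tensor `v₁ ⊗ ⋯ ⊗ vₖ`. -/
def ProjTensorPower.tmul {k : ℕ} (v : Fin k → V) : ProjTensorPower V k :=
  ((PiTensorProduct.tprod ℂ v : ⨂[ℂ]^k V) : UniformSpace.Completion (⨂[ℂ]^k V))

lemma norm_mulEquiv_tprod_tprod_le {i j : ℕ} (v : Fin i → V) (w : Fin j → V) :
    ‖(TensorPower.mulEquiv (PiTensorProduct.tprod ℂ v ⊗ₜ[ℂ] PiTensorProduct.tprod ℂ w) :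
      ⨂[ℂ]^(i + j) V)‖ ≤ (∏ l, ‖v l‖) * ∏ l, ‖w l‖ := by
  rw [← TensorPower.gMul_def, TensorPower.tprod_mul_tprod]
  refine (PiTensorProduct.projectiveSeminorm_tprod_le _).trans_eq ?_
  simp [Fin.prod_univ_add]

lemma norm_mulEquiv_tprod_le {i j : ℕ} (v : Fin i → V) (y : ⨂[ℂ]^j V) :
    ‖(TensorPower.mulEquiv (PiTensorProduct.tprod ℂ v ⊗ₜ[ℂ] y) : ⨂[ℂ]^(i + j) V)‖ ≤
      (∏ l, ‖v l‖) * ‖y‖ := by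
  let L : ⨂[ℂ]^j V →ₗ[ℂ] ⨂[ℂ]^(i + j) V :=
    (TensorPower.mulEquiv (R := ℂ) (M := V) (n := i) (m := j)).toLinearMap ∘ₗ
      TensorProduct.mk ℂ (⨂[ℂ]^i V) (⨂[ℂ]^j V) (PiTensorProduct.tprod ℂ v)
  let f : ContinuousMultilinearMap ℂ (fun _ : Fin j => V) (⨂[ℂ]^(i + j) V) :=
    MultilinearMap.mkContinuous (L.compMultilinearMap (PiTensorProduct.tprod ℂ)) (∏ l, ‖v l‖)
      (fun w => norm_mulEquiv_tprod_tprod_le v w)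
  have h := PiTensorProduct.norm_eval_le_projectiveSeminorm f y
  have hf : ‖f‖ ≤ ∏ l, ‖v l‖ := MultilinearMap.mkContinuous_norm_le _ (by positivity) _
  have e : PiTensorProduct.lift f.toMultilinearMap = L := by
    ext w
    simp only [LinearMap.compMultilinearMap_apply, PiTensorProduct.lift.tprod]
    rfl
  rw [e] at h
  exact h.trans (by gcongr)

lemma norm_mulEquiv_le {i j : ℕ} (x : ⨂[ℂ]^i V) (y : ⨂[ℂ]^j V) :
    ‖(TensorPower.mulEquiv (x ⊗ₜ[ℂ] y) : ⨂[ℂ]^(i + j) V)‖ ≤ ‖x‖ * ‖y‖ := by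
  let L : ⨂[ℂ]^i V →ₗ[ℂ] ⨂[ℂ]^(i + j) V :=
    (TensorPower.mulEquiv (R := ℂ) (M := V) (n := i) (m := j)).toLinearMap ∘ₗ
      (TensorProduct.mk ℂ (⨂[ℂ]^i V) (⨂[ℂ]^j V)).flip y
  let f : ContinuousMultilinearMap ℂ (fun _ : Fin i => V) (⨂[ℂ]^(i + j) V) :=
    MultilinearMap.mkContinuous (L.compMultilinearMap (PiTensorProduct.tprod ℂ)) ‖y‖
      (fun v => (norm_mulEquiv_tprod_le v y).trans_eq (mul_comm _ _))
  have h := PiTensorProduct.norm_eval_le_projectiveSeminorm f x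
  have hf : ‖f‖ ≤ ‖y‖ := MultilinearMap.mkContinuous_norm_le _ (by positivity) _
  have e : PiTensorProduct.lift f.toMultilinearMap = L := by
    ext w
    simp only [LinearMap.compMultilinearMap_apply, PiTensorProduct.lift.tprod]
    rfl
  rw [e] at h
  refine h.trans ?_
  rw [mul_comm]
  gcongr

/-- Concatenation of algebraic tensors, as a bounded bilinear map. -/
def tensorConcat (i j : ℕ) : ⨂[ℂ]^i V →L[ℂ] ⨂[ℂ]^j V →L[ℂ] ⨂[ℂ]^(i + j) V :=
  LinearMap.mkContinuous₂
    ((TensorProduct.mk ℂ (⨂[ℂ]^i V) (⨂[ℂ]^j V)).compr₂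
      (TensorPower.mulEquiv (R := ℂ) (M := V) (n := i) (m := j)).toLinearMap) 1
    (fun x y => by simpa using norm_mulEquiv_le x y)

/-- Concatenation of tensors, extended by continuity to completed projective tensor powers. -/
def ProjTensorPower.concat (i j : ℕ) :
    ProjTensorPower V i →L[ℂ] ProjTensorPower V j →L[ℂ] ProjTensorPower V (i + j) :=
  (((ContinuousLinearMap.compL ℂ _ _ _ UniformSpace.Completion.toComplL) ∘L
    tensorConcat i j).flip.fromCompletion.flip).fromCompletion

lemma ProjTensorPower.concat_coe {i j : ℕ} (x : ⨂[ℂ]^i V) (y : ⨂[ℂ]^j V) :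
    ProjTensorPower.concat i j (x : ProjTensorPower V i) (y : ProjTensorPower V j) =
      ((TensorPower.mulEquiv (x ⊗ₜ[ℂ] y) : ⨂[ℂ]^(i + j) V) : ProjTensorPower V (i + j)) := by
  rw [concat, ContinuousLinearMap.fromCompletion_apply_coe, ContinuousLinearMap.flip_apply,
    ContinuousLinearMap.fromCompletion_apply_coe]
  rfl

/-- `(v₁ ⊗ ⋯ ⊗ vᵢ) · (w₁ ⊗ ⋯ ⊗ wⱼ) = v₁ ⊗ ⋯ ⊗ vᵢ ⊗ w₁ ⊗ ⋯ ⊗ wⱼ`. -/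
lemma ProjTensorPower.concat_tmul {i j : ℕ} (v : Fin i → V) (w : Fin j → V) :
    ProjTensorPower.concat i j (tmul v) (tmul w) = tmul (Fin.append v w) := by
  rw [tmul, tmul, concat_coe, ← TensorPower.gMul_def, TensorPower.tprod_mul_tprod]
  rfl

lemma ProjTensorPower.norm_concat_le {i j : ℕ} (x : ProjTensorPower V i)
    (y : ProjTensorPower V j) : ‖concat i j x y‖ ≤ ‖x‖ * ‖y‖ := by
  induction x, y using UniformSpace.Completion.induction_on₂ with
  | hp => exact isClosed_le (by fun_prop) (by fun_prop)
  | ih x y =>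
    rw [concat_coe]
    simpa using norm_mulEquiv_le x y

variable (V)

/-- The `ℓ¹`-direct sum of the completed projective tensor powers of `V`. -/
abbrev BanachTensorAlgebra : Type _ := lp (fun k : ℕ => ProjTensorPower V k) 1

lemma single_coe_congr {a b : GradedMonoid fun k => ⨂[ℂ]^k V} (h : a = b) :
    (lp.single (E := fun k : ℕ => ProjTensorPower V k) 1 a.1 (a.2 : ProjTensorPower V a.1)) =
      lp.single 1 b.1 (b.2 : ProjTensorPower V b.1) := by
  rw [h]

/-- The product of the tensor algebra: concatenation of tensors. -/
def BanachTensorAlgebra.product : L1Product (fun k : ℕ => ProjTensorPower V k) where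
  op := (· + ·)
  unit := 0
  one := ProjTensorPower.tmul Fin.elim0
  mul := ProjTensorPower.concat
  norm_mul_le _ _ := ProjTensorPower.norm_concat_le
  mul_assoc i j k x y z := by
    have hc (l : ℕ) : Continuous (lp.single (E := fun k : ℕ => ProjTensorPower V k) 1 l) :=
      (lp.isometry_single l).continuous
    induction x, y, z using UniformSpace.Completion.induction_on₃ with
    | hp => exact isClosed_eq ((hc _).comp (by fun_prop)) ((hc _).comp (by fun_prop))
    | ih x y z =>
      simp only [ProjTensorPower.concat_coe]
      exact single_coe_congr V
        (mul_assoc (GradedMonoid.mk i x : GradedMonoid fun k => ⨂[ℂ]^k V)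
          (GradedMonoid.mk j y) (GradedMonoid.mk k z))
  one_mul i x := by
    have hc (l : ℕ) : Continuous (lp.single (E := fun k : ℕ => ProjTensorPower V k) 1 l) :=
      (lp.isometry_single l).continuous
    induction x using UniformSpace.Completion.induction_on with
    | hp => exact isClosed_eq ((hc _).comp (by fun_prop)) (hc _)
    | ih x =>
      rw [ProjTensorPower.tmul, ProjTensorPower.concat_coe]
      exact single_coe_congr V (one_mul (GradedMonoid.mk i x : GradedMonoid fun k => ⨂[ℂ]^k V))
  mul_one i x := by
    have hc (l : ℕ) : Continuous (lp.single (E := fun k : ℕ => ProjTensorPower V k) 1 l) :=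
      (lp.isometry_single l).continuous
    induction x using UniformSpace.Completion.induction_on with
    | hp => exact isClosed_eq ((hc _).comp (by fun_prop)) (hc _)
    | ih x =>
      rw [ProjTensorPower.tmul, ProjTensorPower.concat_coe]
      exact single_coe_congr V (mul_one (GradedMonoid.mk i x : GradedMonoid fun k => ⨂[ℂ]^k V))

instance : NormedRing (BanachTensorAlgebra V) := (BanachTensorAlgebra.product V).normedRing

instance : NormedAlgebra ℂ (BanachTensorAlgebra V) :=
  (BanachTensorAlgebra.product V).normedAlgebra

variable {V}

lemma BanachTensorAlgebra.single_tmul_mul_single_tmul {i j : ℕ} (v : Fin i → V) (w : Fin j → V) :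
    (lp.single 1 i (ProjTensorPower.tmul v) * lp.single 1 j (ProjTensorPower.tmul w) :
      BanachTensorAlgebra V) = lp.single 1 (i + j) (ProjTensorPower.tmul (Fin.append v w)) := by
  rw [← ProjTensorPower.concat_tmul]
  exact (BanachTensorAlgebra.product V).mulL_single i j _ _

/-- The inclusion of `V` into its tensor algebra as the tensors of degree one. -/
def BanachTensorAlgebra.incl (v : V) : BanachTensorAlgebra V :=
  lp.single (E := fun k : ℕ => ProjTensorPower V k) 1 1 (ProjTensorPower.tmul ![v])

end TensorAlgebra

end

/-! A cochain on the tensor algebra `T(V)` is determined by its values on elementary tensors, that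
is, on tuples of words in the vectors of `V`. Such a tuple is a word written around a circle,
together with the cuts that separate its entries: the faces of the coboundary remove one cut each, and
cyclicity means that `T` only depends on the cyclically ordered cuts, up to the usual sign. For a
fixed cyclic word, cyclic cochains are therefore like the alternating cochains of a simplex whose
vertices are the possible cuts, and every letter `z` gives a cone contraction: insert the cut just
before `z`. Choosing a letter rather than a gap as the apex settles where the new cut goes among
equal cuts.

A single letter cannot be chosen consistently for all tuples, and the sum over all letters
(`cutSum`) is unbounded, but the average (`cutHomotopy`) is both natural and bounded. It satisfies
`δ h + h δ = -1` on cyclic cochains of positive degree at all tuples that have a letter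
(`wordCoboundary_cutHomotopy_add`), and it preserves cyclicity. So a cyclic cocycle of positive
degree that vanishes at `(1, …, 1)` is a coboundary (`HasWordHomotopy.exists_cyclic_primitive`).

In odd degree, cyclicity forces `T (1, …, 1) = 0`, and the cohomology vanishes. In even degree
evaluation at `(1, …, 1)` is a bounded functional that kills coboundaries, its kernel on cocycles is
the space of coboundaries, and it is `1` at the cocycle `ε ⊗ ⋯ ⊗ ε` of a character `ε`; so it
identifies the cohomology, with its topology, with `ℂ`.

That the homotopy of a bounded cochain is again a bounded cochain rests on the extension of
letter-linear functions (`BanachTensorAlgebra.exists_multilinear_of_letterLinear`). The isomorphism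
with `ℓ¹` of the free monoid comes from the universal properties of the two algebras for contractive
maps (`exists_isometric_algEquiv`), and carries the word homotopy across
(`HasWordHomotopy.of_algEquiv`). -/

noncomputable section

/-! ### Face, rotation and cut operations on tuples -/

section Tuples

variable {M : Type*} [Monoid M]

/-- The tuple `(a₀, …, aⱼ aⱼ₊₁, …, aₙ₊₁)`: `mergeFace` for an arbitrary monoid, so that it
applies to tuples of words as well as to tuples of algebra elements. -/
def mergeAt {n : ℕ} (j : Fin (n + 1)) (a : Fin (n + 2) → M) : Fin (n + 1) → M :=
  Fin.contractNth j.castSucc (· * ·) a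

/-- The tuple `(a₁, …, aₙ, aₙ₊₁ a₀)`: `wrapFace` for an arbitrary monoid. -/
def wrapAround {n : ℕ} (a : Fin (n + 2) → M) : Fin (n + 1) → M :=
  Fin.snoc (α := fun _ => M) (fun i : Fin n => a i.succ.castSucc) (a (Fin.last (n + 1)) * a 0)

/-- The tuple `(aₙ, a₀, …, aₙ₋₁)`. -/
def rotateTuple {n : ℕ} (a : Fin (n + 1) → M) : Fin (n + 1) → M :=
  Fin.cons (α := fun _ => M) (a (Fin.last n)) (Fin.init a)

/-- The tuple `(x₀, …, xᵢ₋₁, u, v, xᵢ₊₁, …, xₙ)`, in which `u, v` replace the entry `xᵢ`. It is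
meant for `u * v = x i`, when the new tuple arises by cutting `xᵢ`. -/
def splitEntry {n : ℕ} (i : Fin (n + 1)) (u v : M) (x : Fin (n + 1) → M) : Fin (n + 2) → M :=
  fun l => if h : (l : ℕ) < i then x ⟨l, by omega⟩ else
    if (l : ℕ) = i then u else if (l : ℕ) = i + 1 then v else x ⟨l - 1, by omega⟩

lemma mergeAt_apply {n : ℕ} (j : Fin (n + 1)) (a : Fin (n + 2) → M) (l : Fin (n + 1)) :
    mergeAt j a l = if (l : ℕ) < j then a ⟨l, by omega⟩ else
      if (l : ℕ) = j then a ⟨l, by omega⟩ * a ⟨l + 1, by omega⟩ else a ⟨l + 1, by omega⟩ := by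
  simp only [mergeAt, Fin.contractNth, Fin.val_castSucc]
  rfl

lemma wrapAround_apply {n : ℕ} (a : Fin (n + 2) → M) (l : Fin (n + 1)) :
    wrapAround a l = if h : (l : ℕ) = n then a ⟨n + 1, by omega⟩ * a ⟨0, by omega⟩ else
      a ⟨l + 1, by omega⟩ := by
  refine Fin.lastCases ?_ (fun l => ?_) l
  · simp [wrapAround]; rfl
  · simp [wrapAround, l.isLt.ne]; rfl

lemma rotateTuple_apply {n : ℕ} (a : Fin (n + 1) → M) (l : Fin (n + 1)) :
    rotateTuple a l = if (l : ℕ) = 0 then a (Fin.last n) else a ⟨l - 1, by omega⟩ := by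
  refine Fin.cases ?_ (fun l => ?_) l
  · simp [rotateTuple]
  · simp [rotateTuple, Fin.init]; rfl

lemma mergeAt_splitEntry_self {n : ℕ} (i : Fin (n + 1)) (u v : M) (x : Fin (n + 1) → M)
    (h : u * v = x i) : mergeAt i (splitEntry i u v x) = x := by
  funext l
  simp only [mergeAt_apply, splitEntry, Fin.val_castSucc, Fin.val_succ]
  grind

lemma splitEntry_mergeAt_of_ne {n : ℕ} (i j : Fin (n + 1)) (hij : i ≠ j) (u v : M)
    (a : Fin (n + 2) → M) :
    splitEntry i u v (mergeAt j a) =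
      mergeAt ((j.succ.succAbove i).succAbove j) (splitEntry (j.succ.succAbove i) u v a) := by
  obtain ⟨j, hj⟩ := j
  obtain ⟨i, hi⟩ := i
  funext ⟨l, hl⟩
  simp only [mergeAt_apply, splitEntry, Fin.castSucc_mk, Fin.succ_mk, Fin.succAbove, Fin.mk_lt_mk,
    Fin.lt_def, apply_ite Fin.val]
  grind

lemma splitEntry_mergeAt_left {n : ℕ} (j : Fin (n + 1)) (u v : M) (a : Fin (n + 2) → M) :
    splitEntry j u (v * a j.succ) (mergeAt j a) =
      mergeAt (j.castSucc.succAbove j) (splitEntry j.castSucc u v a) := by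
  obtain ⟨j, hj⟩ := j
  funext ⟨l, hl⟩
  simp only [mergeAt_apply, splitEntry, Fin.castSucc_mk, Fin.succ_mk, Fin.succAbove, Fin.mk_lt_mk,
    Fin.lt_def, apply_ite Fin.val]
  grind

lemma splitEntry_mergeAt_right {n : ℕ} (j : Fin (n + 1)) (u v : M) (a : Fin (n + 2) → M) :
    splitEntry j (a j.castSucc * u) v (mergeAt j a) =
      mergeAt (j.succ.succAbove j) (splitEntry j.succ u v a) := by
  obtain ⟨j, hj⟩ := j
  funext ⟨l, hl⟩
  simp only [mergeAt_apply, splitEntry, Fin.castSucc_mk, Fin.succ_mk, Fin.succAbove, Fin.mk_lt_mk,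
    Fin.lt_def, apply_ite Fin.val]
  grind

lemma splitEntry_wrapAround_castSucc {n : ℕ} (i : Fin n) (u v : M) (a : Fin (n + 2) → M) :
    splitEntry i.castSucc u v (wrapAround a) = wrapAround (splitEntry i.castSucc.succ u v a) := by
  funext l
  simp only [wrapAround_apply, splitEntry, Fin.val_castSucc, Fin.val_succ, Fin.val_last,
    Fin.val_zero]
  grind

lemma splitEntry_wrapAround_last_left {n : ℕ} (u v : M) (a : Fin (n + 2) → M) :
    splitEntry (Fin.last n) u (v * a 0) (wrapAround a) =
      wrapAround (splitEntry (Fin.last (n + 1)) u v a) := by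
  funext l
  simp only [wrapAround_apply, splitEntry, Fin.val_castSucc, Fin.val_succ, Fin.val_last,
    Fin.val_zero]
  grind

lemma splitEntry_wrapAround_last_right {n : ℕ} (u v : M) (a : Fin (n + 2) → M) :
    rotateTuple (splitEntry (Fin.last n) (a (Fin.last (n + 1)) * u) v (wrapAround a)) =
      wrapAround (splitEntry 0 u v a) := by
  funext l
  simp only [rotateTuple_apply, wrapAround_apply, splitEntry, Fin.val_castSucc, Fin.val_succ,
    Fin.val_last, Fin.val_zero]
  grind

lemma splitEntry_succ_rotateTuple {n : ℕ} (i : Fin n) (u v : M) (x : Fin (n + 1) → M) :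
    splitEntry i.succ u v (rotateTuple x) = rotateTuple (splitEntry i.castSucc u v x) := by
  funext l
  simp only [rotateTuple_apply, splitEntry, Fin.val_castSucc, Fin.val_succ, Fin.val_last]
  grind

lemma splitEntry_zero_rotateTuple {n : ℕ} (u v : M) (x : Fin (n + 1) → M) :
    splitEntry 0 u v (rotateTuple x) =
      rotateTuple (rotateTuple (splitEntry (Fin.last n) u v x)) := by
  funext l
  simp only [rotateTuple_apply, splitEntry, Fin.val_castSucc, Fin.val_succ, Fin.val_last,
    Fin.val_zero]
  grind

lemma splitEntry_update_self {n : ℕ} (i : Fin (n + 1)) (u v w : M) (x : Fin (n + 1) → M) :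
    splitEntry i u v (Function.update x i w) = splitEntry i u v x := by
  funext l
  simp only [splitEntry, Function.update_apply, Fin.ext_iff]
  grind

lemma splitEntry_update_of_ne {n : ℕ} (i k : Fin (n + 1)) (hk : i ≠ k) (u v w : M)
    (x : Fin (n + 1) → M) :
    splitEntry i u v (Function.update x k w) =
      Function.update (splitEntry i u v x) (i.succ.succAbove k) w := by
  funext l
  simp only [splitEntry, Function.update_apply, Fin.ext_iff, Fin.succAbove, Fin.lt_def,
    Fin.val_castSucc, Fin.val_succ]
  grind

lemma splitEntry_eq_update_left {n : ℕ} (i : Fin (n + 1)) (u u' v : M) (x : Fin (n + 1) → M) :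
    splitEntry i u v x = Function.update (splitEntry i u' v x) i.castSucc u := by
  funext l
  simp only [splitEntry, Function.update_apply, Fin.ext_iff, Fin.val_castSucc]
  grind

lemma splitEntry_eq_update_right {n : ℕ} (i : Fin (n + 1)) (u v v' : M) (x : Fin (n + 1) → M) :
    splitEntry i u v x = Function.update (splitEntry i u v' x) i.succ v := by
  funext l
  simp only [splitEntry, Function.update_apply, Fin.ext_iff, Fin.val_succ]
  grind

lemma prod_splitEntry {N : Type*} [CommMonoid N] (s : M →* N) {n : ℕ} (i : Fin (n + 1)) (u v : M)
    (x : Fin (n + 1) → M) (h : u * v = x i) :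
    ∏ l, s (splitEntry i u v x l) = ∏ l, s (x l) := by
  rw [Fin.prod_univ_succAbove _ i.castSucc, Fin.prod_univ_succAbove _ i,
    Fin.prod_univ_succAbove (fun l => s (x l)) i, ← mul_assoc]
  congr 1
  · simp only [splitEntry, Fin.succAbove, Fin.lt_def, ← h, map_mul]
    simp
  · refine Finset.prod_congr rfl fun l _ => congrArg s ?_
    simp only [splitEntry, Fin.succAbove, Fin.lt_def]
    grind

lemma prod_mergeAt {N : Type*} [CommMonoid N] (s : M →* N) {n : ℕ} (j : Fin (n + 1))
    (a : Fin (n + 2) → M) : ∏ l, s (mergeAt j a l) = ∏ l, s (a l) := by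
  rw [← prod_splitEntry s j (a j.castSucc) (a j.succ) (mergeAt j a) (by simp [mergeAt_apply]; rfl)]
  refine Finset.prod_congr rfl fun l _ => congrArg s ?_
  obtain ⟨j, hj⟩ := j
  obtain ⟨l, hl⟩ := l
  simp only [splitEntry, mergeAt_apply, Fin.castSucc_mk, Fin.succ_mk]
  grind

lemma prod_wrapAround {N : Type*} [CommMonoid N] (s : M →* N) {n : ℕ}
    (a : Fin (n + 2) → M) : ∏ l, s (wrapAround a l) = ∏ l, s (a l) := by
  rw [Fin.prod_univ_castSucc, Fin.prod_univ_succ (fun l => s (a l)), Fin.prod_univ_castSucc]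
  simp [wrapAround]
  rw [mul_comm (s (a (Fin.last _))), mul_left_comm]

lemma prod_rotateTuple {N : Type*} [CommMonoid N] (s : M →* N) {n : ℕ}
    (a : Fin (n + 1) → M) : ∏ l, s (rotateTuple a l) = ∏ l, s (a l) := by
  rw [Fin.prod_univ_succ, Fin.prod_univ_castSucc (fun l => s (a l)), mul_comm]
  rfl

end Tuples

/-! ### Sums over the proper cuts of a word -/

section Splittings

variable {α E : Type*} [AddCommMonoid E]

/-- The sum of `φ u v` over all factorizations `w = u * v` with `v ≠ 1`, one for each letter of `w`
(the first letter of `v`). Excluding `v = 1` makes the letters, not the gaps between them, the index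
set of the sum, and gives it the derivation rule `splitSum_mul`. -/
def splitSum (φ : FreeMonoid α → FreeMonoid α → E) (w : FreeMonoid α) : E :=
  ∑ j ∈ Finset.range w.length,
    φ (FreeMonoid.ofList (w.toList.take j)) (FreeMonoid.ofList (w.toList.drop j))

/-- A letter of `a * b` is a letter of `a` or of `b`. -/
lemma splitSum_mul (φ : FreeMonoid α → FreeMonoid α → E) (a b : FreeMonoid α) :
    splitSum φ (a * b) =
      splitSum (fun u v => φ u (v * b)) a + splitSum (fun u v => φ (a * u) v) b := by
  have hl : (a * b).length = a.length + b.length := FreeMonoid.length_mul a b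
  rw [splitSum, hl, Finset.sum_range_add]
  congr 1
  · refine Finset.sum_congr rfl fun j hj => ?_
    have hj' : j ≤ a.toList.length := (Finset.mem_range.1 hj).le
    rw [FreeMonoid.toList_mul, List.take_append_of_le_length hj',
      List.drop_append_of_le_length hj']
    rfl
  · refine Finset.sum_congr rfl fun j _ => ?_
    have h1 : a.length = a.toList.length := rfl
    rw [FreeMonoid.toList_mul, h1, List.take_length_add_append, List.drop_length_add_append]
    rfl

lemma splitSum_of (φ : FreeMonoid α → FreeMonoid α → E) (x : α) :
    splitSum φ (FreeMonoid.of x) = φ 1 (FreeMonoid.of x) := by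
  simp [splitSum]

lemma splitSum_congr {φ ψ : FreeMonoid α → FreeMonoid α → E} {w : FreeMonoid α}
    (h : ∀ u v, u * v = w → φ u v = ψ u v) : splitSum φ w = splitSum ψ w :=
  Finset.sum_congr rfl fun j _ => h _ _ (List.take_append_drop j w.toList)

lemma splitSum_add (φ ψ : FreeMonoid α → FreeMonoid α → E) (w : FreeMonoid α) :
    splitSum (fun u v => φ u v + ψ u v) w = splitSum φ w + splitSum ψ w :=
  Finset.sum_add_distrib

lemma splitSum_sum {ι : Type*} (s : Finset ι) (φ : ι → FreeMonoid α → FreeMonoid α → E)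
    (w : FreeMonoid α) :
    splitSum (fun u v => ∑ i ∈ s, φ i u v) w = ∑ i ∈ s, splitSum (φ i) w :=
  Finset.sum_comm

lemma splitSum_mul_left (c : ℂ) (φ : FreeMonoid α → FreeMonoid α → ℂ) (w : FreeMonoid α) :
    splitSum (fun u v => c * φ u v) w = c * splitSum φ w :=
  (Finset.mul_sum _ _ _).symm

lemma splitSum_const (c : ℂ) (w : FreeMonoid α) :
    splitSum (fun _ _ => c) w = w.length * c := by
  simp [splitSum]

lemma norm_splitSum_le (φ : FreeMonoid α → FreeMonoid α → ℂ) (w : FreeMonoid α) (C : ℝ)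
    (h : ∀ u v, u * v = w → ‖φ u v‖ ≤ C) : ‖splitSum φ w‖ ≤ w.length * C := by
  refine (norm_sum_le_of_le _ (fun j _ => h _ _ (List.take_append_drop j w.toList))).trans_eq ?_
  simp

end Splittings

/-! ### The cone homotopy on functions of tuples of words -/

section Homotopy

variable {α : Type*} {n : ℕ}

/-- The number of letters in a tuple of words. -/
def totalLength (x : Fin n → FreeMonoid α) : ℕ := ∑ i, (x i).length

/-- The Hochschild coboundary of a function of tuples of words. -/
def wordCoboundary (f : (Fin (n + 1) → FreeMonoid α) → ℂ) (a : Fin (n + 2) → FreeMonoid α) : ℂ :=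
  f (wrapAround a) + ∑ j : Fin (n + 1), (-1 : ℂ) ^ ((j : ℕ) + 1) * f (mergeAt j a)

/-- The sum over all letters `z` of the tuple `x` of the signed values of `f` at `x` cut just before
`z`. Each letter contributes the contraction of the simplicial complex of cuts onto the cut before
that letter. -/
def cutSum (f : (Fin (n + 2) → FreeMonoid α) → ℂ) (x : Fin (n + 1) → FreeMonoid α) : ℂ :=
  ∑ i : Fin (n + 1), (-1 : ℂ) ^ (i : ℕ) * splitSum (fun u v => f (splitEntry i u v x)) (x i)

/-- The average over the letters of `x` of the signed values of `f` at `x` cut before that letter.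
Dividing by the number of letters is what keeps the homotopy bounded. At tuples without letters both
the sum and the (junk) inverse vanish, and the value is `0`. -/
def cutHomotopy (f : (Fin (n + 2) → FreeMonoid α) → ℂ) (x : Fin (n + 1) → FreeMonoid α) : ℂ :=
  (totalLength x : ℂ)⁻¹ * cutSum f x

/-- The total length as a product of values of a monoid homomorphism, the form in which the
`prod_` lemmas on tuples apply. -/
lemma ofAdd_totalLength (x : Fin n → FreeMonoid α) :
    Multiplicative.ofAdd (totalLength x) =
      ∏ l, FreeMonoid.lift (fun _ : α => Multiplicative.ofAdd 1) (x l) := by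
  have h (w : FreeMonoid α) :
      FreeMonoid.lift (fun _ : α => Multiplicative.ofAdd 1) w = Multiplicative.ofAdd w.length := by
    induction w using FreeMonoid.inductionOn' with
    | one => simp
    | of_mul x w ih => simp [ih, FreeMonoid.length_mul, ofAdd_add]
  simp [totalLength, h, ofAdd_sum]

lemma totalLength_mergeAt (j : Fin (n + 1)) (a : Fin (n + 2) → FreeMonoid α) :
    totalLength (mergeAt j a) = totalLength a :=
  Multiplicative.ofAdd.injective (by simp only [ofAdd_totalLength, prod_mergeAt])

lemma totalLength_wrapAround (a : Fin (n + 2) → FreeMonoid α) :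
    totalLength (wrapAround a) = totalLength a :=
  Multiplicative.ofAdd.injective (by simp only [ofAdd_totalLength, prod_wrapAround])

lemma totalLength_rotateTuple (a : Fin (n + 1) → FreeMonoid α) :
    totalLength (rotateTuple a) = totalLength a :=
  Multiplicative.ofAdd.injective (by simp only [ofAdd_totalLength, prod_rotateTuple])

/-- Merging and then cutting is cutting and then merging at another place. The merges left out on
the right, those at the place of the cut itself, undo the cut. -/
lemma cutSum_mergeAt (f : (Fin (n + 2) → FreeMonoid α) → ℂ) (a : Fin (n + 2) → FreeMonoid α)
    (j : Fin (n + 1)) :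
    (-1 : ℂ) ^ ((j : ℕ) + 1) * cutSum f (mergeAt j a) =
      - ∑ i : Fin (n + 2), (-1 : ℂ) ^ (i : ℕ) * ((-1 : ℂ) ^ ((i.succAbove j : ℕ) + 1) *
        splitSum (fun u v => f (mergeAt (i.succAbove j) (splitEntry i u v a))) (a i)) := by
  set g : Fin (n + 2) → ℂ := fun i =>
    splitSum (fun u v => f (mergeAt (i.succAbove j) (splitEntry i u v a))) (a i) with hg
  have hj : splitSum (fun u v => f (splitEntry j u v (mergeAt j a))) (mergeAt j a j) =
      g j.castSucc + g j.succ := by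
    have : mergeAt j a j = a j.castSucc * a j.succ := by simp [mergeAt_apply]; rfl
    rw [this, splitSum_mul]
    simp only [splitEntry_mergeAt_left, splitEntry_mergeAt_right, hg]
  have hne (i : Fin (n + 1)) (hi : i ≠ j) :
      splitSum (fun u v => f (splitEntry i u v (mergeAt j a))) (mergeAt j a i) =
        g (j.succ.succAbove i) := by
    have : mergeAt j a i = a (j.succ.succAbove i) := by
      simp only [mergeAt_apply, Fin.succAbove, Fin.lt_def, Fin.val_castSucc, Fin.val_succ]
      rcases lt_or_gt_of_ne (fun h => hi (Fin.ext h) : (i : ℕ) ≠ j) with h | h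
      · rw [if_pos h, if_pos (by omega)]; rfl
      · rw [if_neg (by omega), if_neg (by omega), if_neg (by omega)]; rfl
    simp only [this, splitEntry_mergeAt_of_ne i j hi, hg]
  have hs : ((-1 : ℂ) ^ (j : ℕ)) * (-1) ^ (j : ℕ) = 1 := by rw [← mul_pow]; simp
  have hsucc : ((j.succ.succAbove j : Fin (n + 2)) : ℕ) = j := by simp
  have hcast : ((j.castSucc.succAbove j : Fin (n + 2)) : ℕ) = j + 1 := by simp
  change _ = - ∑ i : Fin (n + 2), (-1 : ℂ) ^ (i : ℕ) *
    ((-1 : ℂ) ^ ((i.succAbove j : ℕ) + 1) * g i)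
  -- On the right, the cuts of the merged entry `a j * a (j + 1)` are indexed by `j` and `j + 1`.
  -- Taking out `j + 1` leaves a sum over `i` that matches the left side except at `i = j`.
  rw [Fin.sum_univ_succAbove _ j.succ, cutSum, Finset.mul_sum, eq_neg_iff_add_eq_zero,
    add_left_comm, ← Finset.sum_add_distrib, Finset.sum_eq_single j]
  · rw [hj, Fin.succAbove_succ_self]
    simp only [Fin.val_castSucc, Fin.val_succ, hcast, hsucc, pow_succ]
    ring
  · intro i _ hi
    rw [hne i hi]
    have hsign : (-1 : ℂ) ^ ((j : ℕ) + 1) * (-1 : ℂ) ^ (i : ℕ) +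
        (-1 : ℂ) ^ ((j.succ.succAbove i : Fin (n + 2)) : ℕ) *
        (-1 : ℂ) ^ ((((j.succ.succAbove i).succAbove j : Fin (n + 2)) : ℕ) + 1) = 0 := by
      simp only [Fin.succAbove, Fin.lt_def, Fin.val_castSucc, Fin.val_succ, apply_ite Fin.val]
      rcases lt_or_gt_of_ne (fun h => hi (Fin.ext h) : (i : ℕ) ≠ j) with h | h
      · rw [if_pos (by omega), if_neg (by omega)]
        ring
      · rw [if_neg (by omega), if_pos (by omega)]
        ring
    linear_combination (g (j.succ.succAbove i)) * hsign
  · simp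

/-- The analogue of `cutSum_mergeAt` for the last face. A cut in the entry `a 0` moves past the end
of the tuple, which is where cyclicity of `f` is used. -/
lemma cutSum_wrapAround (f : (Fin (n + 2) → FreeMonoid α) → ℂ)
    (hf : ∀ x, (-1 : ℂ) ^ (n + 1) * f (rotateTuple x) = f x) (a : Fin (n + 2) → FreeMonoid α) :
    cutSum f (wrapAround a) = - ∑ i : Fin (n + 2), (-1 : ℂ) ^ (i : ℕ) *
      splitSum (fun u v => f (wrapAround (splitEntry i u v a))) (a i) := by
  have hlast : wrapAround a (Fin.last n) = a (Fin.last (n + 1)) * a 0 := by simp [wrapAround]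
  have hcast (i : Fin n) : wrapAround a i.castSucc = a i.castSucc.succ := by simp [wrapAround]
  have h0 (u v : FreeMonoid α) :
      f (splitEntry (Fin.last n) (a (Fin.last (n + 1)) * u) v (wrapAround a)) =
        (-1 : ℂ) ^ (n + 1) * f (wrapAround (splitEntry 0 u v a)) := by
    rw [← hf, splitEntry_wrapAround_last_right]
  rw [cutSum, Fin.sum_univ_castSucc, hlast, splitSum_mul]
  simp only [h0, hcast, splitEntry_wrapAround_castSucc, splitEntry_wrapAround_last_left,
    splitSum_mul_left]
  rw [Fin.sum_univ_succ, Fin.sum_univ_castSucc]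
  simp only [Fin.val_castSucc, Fin.val_succ, Fin.val_last, Fin.val_zero, pow_zero, one_mul,
    Fin.succ_last, pow_succ, mul_neg, mul_one, neg_mul, Finset.sum_neg_distrib]
  have hs : ((-1 : ℂ) ^ n) * (-1) ^ n = 1 := by rw [← mul_pow]; simp
  linear_combination -(splitSum (fun u v => f (wrapAround (splitEntry 0 u v a))) (a 0)) * hs

/-- The homotopy formula before averaging. Each letter contributes `- f a`, from undoing the cut
before it; all other terms cancel in pairs. -/
theorem wordCoboundary_cutSum_add (f : (Fin (n + 2) → FreeMonoid α) → ℂ)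
    (hf : ∀ x, (-1 : ℂ) ^ (n + 1) * f (rotateTuple x) = f x) (a : Fin (n + 2) → FreeMonoid α) :
    wordCoboundary (cutSum f) a + cutSum (wordCoboundary f) a = - (totalLength a * f a) := by
  have h1 (i : Fin (n + 2)) :
      (-1 : ℂ) ^ (i : ℕ) * splitSum (fun u v => wordCoboundary f (splitEntry i u v a)) (a i) =
      (-1 : ℂ) ^ (i : ℕ) * splitSum (fun u v => f (wrapAround (splitEntry i u v a))) (a i)
      + -((a i).length * f a) + ∑ j : Fin (n + 1), (-1 : ℂ) ^ (i : ℕ) *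
        ((-1 : ℂ) ^ ((i.succAbove j : ℕ) + 1) *
        splitSum (fun u v => f (mergeAt (i.succAbove j) (splitEntry i u v a))) (a i)) := by
    simp only [wordCoboundary, splitSum_add, splitSum_sum, splitSum_mul_left]
    rw [Fin.sum_univ_succAbove _ i, splitSum_congr (ψ := fun _ _ => f a)
      (φ := fun u v => f (mergeAt i (splitEntry i u v a)))
      (fun u v h => by rw [mergeAt_splitEntry_self i u v a h]), splitSum_const, ← Finset.mul_sum]
    have hs : ((-1 : ℂ) ^ (i : ℕ)) * (-1) ^ (i : ℕ) = 1 := by rw [← mul_pow]; simp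
    rw [pow_succ]
    linear_combination -((a i).length * f a) * hs
  rw [wordCoboundary, cutSum_wrapAround f hf]
  conv_lhs => enter [2]; rw [cutSum]
  simp only [h1, cutSum_mergeAt, Finset.sum_add_distrib, Finset.sum_neg_distrib]
  rw [Finset.sum_comm, totalLength]
  push_cast
  rw [Finset.sum_mul]
  ring

theorem wordCoboundary_cutHomotopy_add (f : (Fin (n + 2) → FreeMonoid α) → ℂ)
    (hf : ∀ x, (-1 : ℂ) ^ (n + 1) * f (rotateTuple x) = f x) (a : Fin (n + 2) → FreeMonoid α)
    (ha : totalLength a ≠ 0) :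
    wordCoboundary (cutHomotopy f) a + cutHomotopy (wordCoboundary f) a = - f a := by
  have h : wordCoboundary (cutHomotopy f) a =
      (totalLength a : ℂ)⁻¹ * wordCoboundary (cutSum f) a := by
    simp only [wordCoboundary, cutHomotopy, totalLength_mergeAt, totalLength_wrapAround, mul_add,
      Finset.mul_sum]
    simp only [mul_left_comm]
  rw [h, cutHomotopy, ← mul_add, wordCoboundary_cutSum_add f hf]
  have : (totalLength a : ℂ) ≠ 0 := by exact_mod_cast ha
  field_simp

/-- The homotopy maps cyclic functions to cyclic functions. -/
theorem cutHomotopy_rotateTuple (f : (Fin (n + 2) → FreeMonoid α) → ℂ)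
    (hf : ∀ x, (-1 : ℂ) ^ (n + 1) * f (rotateTuple x) = f x) (x : Fin (n + 1) → FreeMonoid α) :
    (-1 : ℂ) ^ n * cutHomotopy f (rotateTuple x) = cutHomotopy f x := by
  have hs : ((-1 : ℂ) ^ n) * (-1) ^ n = 1 := by rw [← mul_pow]; simp
  have hr (y) : f (rotateTuple y) = (-1 : ℂ) ^ (n + 1) * f y := by
    rw [← hf y, pow_succ]
    linear_combination -(f (rotateTuple y)) * hs
  have hrr (y) : f (rotateTuple (rotateTuple y)) = f y := by
    rw [hr, hf]
  have h0 : rotateTuple x 0 = x (Fin.last n) := rfl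
  have h1 (i : Fin n) : rotateTuple x i.succ = x i.castSucc := rfl
  rw [cutHomotopy, cutHomotopy, totalLength_rotateTuple, mul_left_comm]
  congr 1
  rw [cutSum, cutSum, Fin.sum_univ_succ, Fin.sum_univ_castSucc]
  simp only [h0, h1, splitEntry_zero_rotateTuple, splitEntry_succ_rotateTuple, hrr, hr,
    splitSum_mul_left,
    Fin.val_succ, Fin.val_zero, Fin.val_castSucc, Fin.val_last, pow_succ, pow_zero, one_mul,
    mul_add, Finset.mul_sum]
  rw [add_comm]
  congr 1
  refine Finset.sum_congr rfl fun i _ => ?_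
  linear_combination ((-1) ^ (i : ℕ) *
    splitSum (fun u v => f (splitEntry i.castSucc u v x)) (x i.castSucc)) * hs

end Homotopy

/-! ### Cyclic cohomology of algebras generated by words -/

section WordHomotopy

variable {A : Type*} [NormedRing A] [NormedAlgebra ℂ A] {α : Type*} {n : ℕ}

/-- The algebra `A` is topologically spanned by the words `e w`, the averaged cut homotopy of the
values of a bounded cochain on words is again given by a bounded cochain, and `A` has a continuous
character. This is all that the computation of the cyclic cohomology requires of `A`. -/
structure HasWordHomotopy (e : FreeMonoid α →* A) : Prop where
  dense_span : Dense (Submodule.span ℂ (Set.range e) : Set A)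
  exists_homotopy : ∀ (n : ℕ) (T : SimplicialCochain A (n + 1)), ∃ S : SimplicialCochain A n,
    ∀ x, S (e ∘ x) = cutHomotopy (fun y => T (e ∘ y)) x
  exists_character : ∃ ε : A →ₐ[ℂ] ℂ, Continuous ε

lemma continuousMultilinearMap_ext_of_dense_span {s : Set A}
    (hs : Dense (Submodule.span ℂ s : Set A))
    {S T : ContinuousMultilinearMap ℂ (fun _ : Fin n => A) ℂ}
    (h : ∀ a : Fin n → A, (∀ i, a i ∈ s) → S a = T a) : S = T := by
  -- The entries indexed by `t` are freed one at a time.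
  have key (t : Finset (Fin n)) : ∀ a : Fin n → A, (∀ i ∉ t, a i ∈ s) → S a = T a := by
    induction t using Finset.induction_on with
    | empty => exact fun a ha => h a fun i => ha i (Finset.notMem_empty i)
    | insert i t _ ih =>
      intro a ha
      have := ContinuousLinearMap.ext_on (f := S.toContinuousLinearMap a i)
        (g := T.toContinuousLinearMap a i) hs fun x hx => ih _ fun k hk => by
          by_cases hki : k = i
          · subst hki
            simpa using hx
          · rw [Function.update_of_ne hki]
            exact ha k (by simp [hki, hk])
      simpa using DFunLike.congr_fun this (a i)
  ext a
  exact key Finset.univ a fun i hi => absurd (Finset.mem_univ i) hi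

lemma SimplicialCochain.ext_of_dense_span {e : FreeMonoid α →* A}
    (he : Dense (Submodule.span ℂ (Set.range e) : Set A)) {S T : SimplicialCochain A n}
    (h : ∀ x, S (e ∘ x) = T (e ∘ x)) : S = T := by
  refine continuousMultilinearMap_ext_of_dense_span (S := S.toMap) (T := T.toMap) he fun a ha => ?_
  choose x hx using ha
  obtain rfl : e ∘ x = a := funext hx
  exact h x

/-- The cochain `a ↦ T (aₙ, a₀, …, aₙ₋₁)`. -/
def SimplicialCochain.rotated (T : SimplicialCochain A n) : SimplicialCochain A n :=
  T.toMap.domDomCongr (finRotate (n + 1)).symm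

lemma SimplicialCochain.rotated_apply (T : SimplicialCochain A n) (a : Fin (n + 1) → A) :
    T.rotated a = T (rotateTuple a) := by
  change T (fun i => a ((finRotate (n + 1)).symm i)) = _
  congr 1
  funext i
  obtain ⟨k, rfl⟩ := (finRotate (n + 1)).surjective i
  rw [Equiv.symm_apply_apply]
  refine Fin.lastCases ?_ (fun k => ?_) k
  · simp [rotateTuple]
  · simp [rotateTuple, Fin.init]

lemma mem_cyclicCochains_iff_rotateTuple {T : SimplicialCochain A n} :
    T ∈ cyclicCochains A n ↔ ∀ a, (-1 : ℂ) ^ n * T (rotateTuple a) = T a := Iff.rfl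

lemma map_rotateTuple (e : FreeMonoid α →* A) (x : Fin (n + 1) → FreeMonoid α) :
    e ∘ rotateTuple x = rotateTuple (e ∘ x) := by
  funext i
  simp only [rotateTuple_apply, Function.comp_apply]
  split_ifs <;> rfl

lemma mem_cyclicCochains_of_words {e : FreeMonoid α →* A}
    (he : Dense (Submodule.span ℂ (Set.range e) : Set A)) {T : SimplicialCochain A n}
    (h : ∀ x, (-1 : ℂ) ^ n * T (e ∘ rotateTuple x) = T (e ∘ x)) : T ∈ cyclicCochains A n := by
  have : (-1 : ℂ) ^ n • T.rotated = T := SimplicialCochain.ext_of_dense_span he fun x => by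
    rw [SimplicialCochain.smul_apply, SimplicialCochain.rotated_apply, ← h x, map_rotateTuple]
  intro a
  conv_rhs => rw [← this]
  rw [SimplicialCochain.smul_apply, SimplicialCochain.rotated_apply]
  rfl

lemma hochschildCoboundary_words (e : FreeMonoid α →* A) (T : SimplicialCochain A n)
    (x : Fin (n + 2) → FreeMonoid α) :
    hochschildCoboundary A n T (e ∘ x) = wordCoboundary (fun y => T (e ∘ y)) x := by
  have hm (j : Fin (n + 1)) : mergeFace j (e ∘ x) = e ∘ mergeAt j x := by
    funext i
    change mergeAt j (e ∘ x) i = _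
    simp only [mergeAt_apply, Function.comp_apply]
    split_ifs <;> simp
  have hw : wrapFace (e ∘ x) = e ∘ wrapAround x := by
    funext i
    change wrapAround (e ∘ x) i = _
    simp only [wrapAround_apply, Function.comp_apply]
    split_ifs <;> simp
  simp only [hochschildCoboundary_apply, wordCoboundary, hm, hw]

/-- A cyclic cocycle of positive degree that vanishes at `(1, …, 1)` is the coboundary of a bounded
cyclic cochain, namely of minus its homotopy. The homotopy formula says nothing about tuples without
letters, that is, about the value at `(1, …, 1)`. -/
theorem HasWordHomotopy.exists_cyclic_primitive {e : FreeMonoid α →* A} (he : HasWordHomotopy e)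
    {T : SimplicialCochain A (n + 1)} (hT : T ∈ cyclicCocycles A (n + 1)) (h1 : T 1 = 0) :
    T ∈ cyclicCoboundaries A (n + 1) := by
  obtain ⟨S, hS⟩ := he.exists_homotopy n T
  have hcyc (x) : (-1 : ℂ) ^ (n + 1) * T (e ∘ rotateTuple x) = T (e ∘ x) := by
    rw [map_rotateTuple]; exact hT.1 _
  have hd (x) : wordCoboundary (fun y => T (e ∘ y)) x = 0 := by
    rw [← hochschildCoboundary_words, LinearMap.mem_ker.1 hT.2]; rfl
  refine ⟨-S, neg_mem (mem_cyclicCochains_of_words he.dense_span fun x => ?_), ?_⟩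
  · rw [hS, hS]
    exact cutHomotopy_rotateTuple _ hcyc x
  · rw [map_neg, neg_eq_iff_eq_neg]
    refine SimplicialCochain.ext_of_dense_span he.dense_span fun x => ?_
    rw [hochschildCoboundary_words]
    simp only [hS]
    change _ = - T (e ∘ x)
    -- Without letters the tuple is `(1, …, 1)`, and both sides vanish.
    by_cases hx : totalLength x = 0
    · have hx1 (i) : x i = 1 :=
        FreeMonoid.length_eq_zero.1 ((Finset.sum_eq_zero_iff.1 hx) i (Finset.mem_univ i))
      have : e ∘ x = 1 := funext fun i => by simp [hx1]
      simp [this, h1, wordCoboundary, cutHomotopy, totalLength_mergeAt, totalLength_wrapAround, hx]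
    · have h0 : cutHomotopy (wordCoboundary fun y => T (e ∘ y)) x = 0 := by
        rw [funext hd]
        simp [cutHomotopy, cutSum, splitSum]
      rw [← wordCoboundary_cutHomotopy_add (fun y => T (e ∘ y)) hcyc x hx, h0, add_zero]

lemma apply_one_eq_zero_of_odd (hn : Odd n) {T : SimplicialCochain A n}
    (hT : T ∈ cyclicCochains A n) : T 1 = 0 := by
  have h := mem_cyclicCochains_iff_rotateTuple.1 hT 1
  have hr : rotateTuple (1 : Fin (n + 1) → A) = 1 := by
    funext i
    simp [rotateTuple_apply]
  rw [hr, hn.neg_one_pow] at h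
  linear_combination (-1 / 2 : ℂ) * h

theorem HasWordHomotopy.subsingleton_cyclicCohomology {e : FreeMonoid α →* A}
    (he : HasWordHomotopy e) (hn : Odd n) : Subsingleton (CyclicCohomology A n) := by
  obtain ⟨n, rfl⟩ : ∃ k, n = k + 1 := ⟨n - 1, by have := hn.pos; omega⟩
  refine Submodule.Quotient.subsingleton_iff.2 (eq_top_iff.2 fun T _ => ?_)
  exact he.exists_cyclic_primitive T.2 (apply_one_eq_zero_of_odd hn T.2.1)

/-- Evaluation at `(1, …, 1)`, as a bounded functional on cochains. -/
def SimplicialCochain.evalOne (A : Type*) [NormedRing A] [NormedAlgebra ℂ A] (n : ℕ) :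
    SimplicialCochain A n →L[ℂ] ℂ :=
  ContinuousMultilinearMap.apply ℂ (fun _ : Fin (n + 1) => A) ℂ 1

lemma wrapFace_one : wrapFace (1 : Fin (n + 2) → A) = 1 := by
  funext i
  change wrapAround (1 : Fin (n + 2) → A) i = _
  simp [wrapAround_apply]

lemma mergeFace_one (j : Fin (n + 1)) : mergeFace j (1 : Fin (n + 2) → A) = 1 := by
  funext i
  change mergeAt j (1 : Fin (n + 2) → A) i = _
  simp [mergeAt_apply]

lemma evalOne_eq_zero_of_mem_cyclicCoboundaries (hn : Even (n + 1))
    {T : SimplicialCochain A (n + 1)}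
    (hT : T ∈ cyclicCoboundaries A (n + 1)) : T 1 = 0 := by
  obtain ⟨S, hS, rfl⟩ := hT
  have h := apply_one_eq_zero_of_odd (by grind) hS
  simp [hochschildCoboundary_apply, wrapFace_one, mergeFace_one, h]

/-- The cochain `(a₀, …, aₙ) ↦ ε a₀ ⋯ ε aₙ`. -/
def characterCochain (ε : A →ₐ[ℂ] ℂ) (hε : Continuous ε) (n : ℕ) : SimplicialCochain A n :=
  (ContinuousMultilinearMap.mkPiAlgebra ℂ (Fin (n + 1)) ℂ).compContinuousLinearMap
    fun _ => (⟨ε.toLinearMap, hε⟩ : A →L[ℂ] ℂ)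

lemma characterCochain_apply (ε : A →ₐ[ℂ] ℂ) (hε : Continuous ε) (a : Fin (n + 1) → A) :
    characterCochain ε hε n a = ∏ i, ε (a i) := rfl

lemma characterCochain_mem_cyclicCocycles (ε : A →ₐ[ℂ] ℂ) (hε : Continuous ε) (hn : Even n) :
    characterCochain ε hε n ∈ cyclicCocycles A n := by
  refine ⟨fun a => ?_, LinearMap.mem_ker.2 (SimplicialCochain.ext fun a => ?_)⟩
  · rw [hn.neg_one_pow, one_mul]
    exact prod_rotateTuple (ε : A →* ℂ) a
  · have hw : ∏ i, ε (wrapFace a i) = ∏ i, ε (a i) := prod_wrapAround (ε : A →* ℂ) a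
    have hm (j : Fin (n + 1)) : ∏ i, ε (mergeFace j a i) = ∏ i, ε (a i) :=
      prod_mergeAt (ε : A →* ℂ) j a
    simp only [hochschildCoboundary_apply, characterCochain_apply, hw, hm, pow_succ,
      mul_neg, neg_mul, mul_one, Finset.sum_neg_distrib]
    rw [← Finset.sum_mul, Fin.sum_univ_eq_sum_range (fun i => (-1 : ℂ) ^ i), neg_one_geom_sum,
      if_neg (by grind)]
    simp

theorem HasWordHomotopy.nonempty_cyclicCohomology_equiv {e : FreeMonoid α →* A}
    (he : HasWordHomotopy e) (hn : Even n) (h2 : 2 ≤ n) :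
    Nonempty (CyclicCohomology A n ≃L[ℂ] ℂ) := by
  obtain ⟨n, rfl⟩ : ∃ k, n = k + 1 := ⟨n - 1, by omega⟩
  obtain ⟨ε, hε⟩ := he.exists_character
  let Z := cyclicCocycles A (n + 1)
  let B : Submodule ℂ Z := (cyclicCoboundaries A (n + 1)).submoduleOf Z
  let f : Z →L[ℂ] ℂ := SimplicialCochain.evalOne A (n + 1) ∘L Z.subtypeL
  have hfB : B ≤ f.ker := fun T hT => evalOne_eq_zero_of_mem_cyclicCoboundaries hn hT
  let g : Z := ⟨_, characterCochain_mem_cyclicCocycles ε hε hn⟩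
  have hg : f g = 1 := by
    change characterCochain ε hε (n + 1) 1 = 1
    simp [characterCochain_apply]
  -- Evaluation at `(1, …, 1)` and the multiples of the class of `g` are inverse to each other.
  let F : (Z ⧸ B) →L[ℂ] ℂ := B.liftQL f hfB
  let G : ℂ →L[ℂ] (Z ⧸ B) := ContinuousLinearMap.toSpanSingleton ℂ (B.mkQ g)
  have hFG (c : ℂ) : F (G c) = c := by
    change F (c • B.mkQ g) = c
    rw [map_smul]
    change c • f g = c
    simp [hg]
  refine ⟨ContinuousLinearEquiv.equivOfInverse F G (fun q => ?_) hFG⟩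
  obtain ⟨T, rfl⟩ := B.mkQ_surjective q
  change f T • B.mkQ g = B.mkQ T
  rw [← map_smul, ← sub_eq_zero, ← map_sub, ← neg_sub, map_neg, neg_eq_zero, Submodule.mkQ_apply,
    Submodule.Quotient.mk_eq_zero]
  refine he.exists_cyclic_primitive (T - f T • g).2 ?_
  change f (T - f T • g) = 0
  rw [map_sub, map_smul, hg]
  simp

end WordHomotopy

/-! ### Bounded linear maps out of an `ℓ¹`-direct sum -/

section L1Extension

variable {ι : Type*} {E : ι → Type*} [∀ i, NormedAddCommGroup (E i)] [∀ i, NormedSpace ℂ (E i)]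

/-- A uniformly bounded family of linear maps on the summands extends to the `ℓ¹`-direct sum. -/
lemma exists_clm_of_norm_le [DecidableEq ι] {F : Type*} [NormedAddCommGroup F] [NormedSpace ℂ F]
    [CompleteSpace F] (L : ∀ i, E i →L[ℂ] F) {C : ℝ} (hC : 0 ≤ C)
    (hL : ∀ i x, ‖L i x‖ ≤ C * ‖x‖) :
    ∃ Φ : lp E 1 →L[ℂ] F, ‖Φ‖ ≤ C ∧ ∀ i x, Φ (lp.single 1 i x) = L i x := by
  have hs (x : lp E 1) : HasSum (fun i => C * ‖x i‖) (C * ‖x‖) :=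
    (L1Product.hasSum_norm x).mul_left C
  have hsum (x : lp E 1) : Summable fun i => L i (x i) :=
    Summable.of_norm_bounded (hs x).summable fun i => hL i _
  let Φ : lp E 1 →ₗ[ℂ] F :=
    { toFun := fun x => ∑' i, L i (x i)
      map_add' := fun x y => by
        rw [← (hsum x).tsum_add (hsum y)]
        simp
      map_smul' := fun c x => by
        rw [RingHom.id_apply, ← (hsum x).tsum_const_smul c]
        simp }
  have hΦ (x : lp E 1) : ‖Φ x‖ ≤ C * ‖x‖ := tsum_of_norm_bounded (hs x) fun i => hL i _
  refine ⟨Φ.mkContinuous C hΦ, LinearMap.mkContinuous_norm_le _ hC _, fun i x => ?_⟩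
  change ∑' k, L k (lp.single (E := E) 1 i x k) = L i x
  rw [tsum_eq_single i, lp.single_apply_self]
  intro k hk
  rw [lp.single_apply_ne _ _ _ hk, map_zero]

lemma dense_of_single_mem [DecidableEq ι] {W : Submodule ℂ (lp E 1)}
    (h : ∀ i x, lp.single 1 i x ∈ W.topologicalClosure) : Dense (W : Set (lp E 1)) := by
  rw [Submodule.dense_iff_topologicalClosure_eq_top, eq_top_iff]
  intro x _
  exact W.isClosed_topologicalClosure.mem_of_tendsto (lp.hasSum_single (by simp) x)
    (Filter.Eventually.of_forall fun s => sum_mem fun i _ => h i _)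

end L1Extension

/-! ### Algebra homomorphisms determined on a dense span -/

section AlgHom

variable {A B : Type*} [NormedRing A] [NormedAlgebra ℂ A] [NormedRing B] [NormedAlgebra ℂ B]
  {M : Type*} [Monoid M]

lemma exists_algHom_of_clm {e : M →* A} (he : Dense (Submodule.span ℂ (Set.range e) : Set A))
    (L : A →L[ℂ] B) (h1 : L 1 = 1) (hL : ∀ u v, L (e (u * v)) = L (e u) * L (e v)) :
    ∃ Φ : A →ₐ[ℂ] B, ∀ a, Φ a = L a := by
  have h (v : M) (a : A) : L (a * e v) = L a * L (e v) := by
    refine DFunLike.congr_fun (ContinuousLinearMap.ext_on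
      (f := L ∘L (ContinuousLinearMap.mul ℂ A).flip (e v))
      (g := (ContinuousLinearMap.mul ℂ B).flip (L (e v)) ∘L L) he ?_) a
    rintro _ ⟨u, rfl⟩
    simp [← hL]
  have h' (a b : A) : L (a * b) = L a * L b := by
    refine DFunLike.congr_fun (ContinuousLinearMap.ext_on
      (f := L ∘L (ContinuousLinearMap.mul ℂ A a))
      (g := ContinuousLinearMap.mul ℂ B (L a) ∘L L) he ?_) b
    rintro _ ⟨v, rfl⟩
    simp [h]
  exact ⟨AlgHom.ofLinearMap L.toLinearMap h1 h', fun _ => rfl⟩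

lemma HasWordHomotopy.of_algEquiv {α : Type*} {e : FreeMonoid α →* A} (he : HasWordHomotopy e)
    (Φ : A ≃ₐ[ℂ] B) (hΦ : Isometry Φ) : HasWordHomotopy ((Φ : A →* B).comp e) := by
  let P : A →L[ℂ] B := ⟨Φ.toLinearMap, hΦ.continuous⟩
  have hΦ' : Isometry Φ.symm := hΦ.right_inv Φ.apply_symm_apply
  let Q : B →L[ℂ] A := ⟨Φ.symm.toLinearMap, hΦ'.continuous⟩
  refine ⟨?_, fun n T => ?_, ?_⟩
  · have := Φ.surjective.denseRange.dense_image hΦ.continuous he.dense_span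
    refine this.mono ?_
    rintro _ ⟨a, ha, rfl⟩
    have := Submodule.mem_map_of_mem (f := Φ.toLinearMap) ha
    rw [Submodule.map_span, ← Set.range_comp] at this
    exact this
  · obtain ⟨S, hS⟩ := he.exists_homotopy n (T.toMap.compContinuousLinearMap fun _ => P)
    refine ⟨S.toMap.compContinuousLinearMap fun _ => Q, fun x => ?_⟩
    have : Q ∘ ((Φ : A →* B).comp e) ∘ x = e ∘ x := funext fun i => Φ.symm_apply_apply _
    change S (Q ∘ ((Φ : A →* B).comp e) ∘ x) = _
    rw [this, hS]
    rfl
  · obtain ⟨ε, hε⟩ := he.exists_character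
    exact ⟨ε.comp Φ.symm, hε.comp hΦ'.continuous⟩

end AlgHom

/-! ### Functions of words that are linear in each letter -/

section LetterLinear

variable {V F : Type*} [NormedAddCommGroup V] [NormedSpace ℂ V] [NormedAddCommGroup F]
  [NormedSpace ℂ F]

/-- A function of words in the vectors of `V` that is linear in each letter. -/
def IsLetterLinear (g : FreeMonoid V → F) : Prop :=
  ∀ (u w : FreeMonoid V) (c : ℂ) (x y : V),
    g (u * .of (c • x + y) * w) = c • g (u * .of x * w) + g (u * .of y * w)

/-- The product of the norms of the letters of a word. -/
def wordNorm (V : Type*) [NormedAddCommGroup V] : FreeMonoid V →* ℝ :=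
  FreeMonoid.lift fun v => ‖v‖

lemma wordNorm_nonneg (w : FreeMonoid V) : 0 ≤ wordNorm V w := by
  induction w using FreeMonoid.inductionOn' with
  | one => simp
  | of_mul x w ih =>
    rw [map_mul]
    exact mul_nonneg (by simp [wordNorm]) ih

lemma wordNorm_ofFn {k : ℕ} (v : Fin k → V) :
    wordNorm V (FreeMonoid.ofList (List.ofFn v)) = ∏ i, ‖v i‖ := by
  rw [wordNorm, FreeMonoid.lift_ofList, List.map_ofFn, List.prod_ofFn]
  rfl

lemma ofFn_update {k : ℕ} (v : Fin k → V) (i : Fin k) (x : V) :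
    FreeMonoid.ofList (List.ofFn (Function.update v i x)) =
      .ofList ((List.ofFn v).take i) * .of x * .ofList ((List.ofFn v).drop (i + 1)) := by
  have h : List.ofFn (Function.update v i x) = (List.ofFn v).set i x := by
    refine List.ext_getElem (by simp) fun j h1 h2 => ?_
    simp only [List.getElem_ofFn, List.getElem_set, Function.update_apply, Fin.ext_iff]
    grind
  rw [h, List.set_eq_take_append_cons_drop, if_pos (by simp)]
  rw [mul_assoc]
  rfl

/-- The restriction of a letter-linear function to the words of length `k`. -/
def IsLetterLinear.toMultilinearMap {g : FreeMonoid V → F} (hg : IsLetterLinear g) (k : ℕ) :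
    MultilinearMap ℂ (fun _ : Fin k => V) F :=
  MultilinearMap.mk' (fun v => g (.ofList (List.ofFn v)))
    (fun v i x y => by
      have := hg (.ofList ((List.ofFn v).take i)) (.ofList ((List.ofFn v).drop (i + 1))) 1 x y
      simpa only [ofFn_update, one_smul] using this)
    (fun v i c x => by
      -- Both vectors zero and `c = 1` in the definition give the value `0` at the letter `0`.
      have h0 := hg (.ofList ((List.ofFn v).take i)) (.ofList ((List.ofFn v).drop (i + 1))) 1 0 0
      have := hg (.ofList ((List.ofFn v).take i)) (.ofList ((List.ofFn v).drop (i + 1))) c x 0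
      simp only [one_smul, add_zero, left_eq_add] at h0
      simpa only [ofFn_update, add_zero, h0] using this)

end LetterLinear

/-! ### Cochains on the tensor algebra as functions of words -/

namespace BanachTensorAlgebra

variable {V : Type*} [NormedAddCommGroup V] [NormedSpace ℂ V]

/-- The product of the letters of a word in the tensor algebra: the word `v₁ ⋯ vₖ` goes to
`v₁ ⊗ ⋯ ⊗ vₖ`. -/
def word (V : Type*) [NormedAddCommGroup V] [NormedSpace ℂ V] :
    FreeMonoid V →* BanachTensorAlgebra V :=
  FreeMonoid.lift incl

@[simp] lemma word_of (v : V) : word V (.of v) = incl v := by simp [word]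

lemma word_ofFn {k : ℕ} (v : Fin k → V) :
    word V (.ofList (List.ofFn v)) = lp.single 1 k (ProjTensorPower.tmul v) := by
  induction k with
  | zero =>
    rw [List.ofFn_zero, FreeMonoid.ofList_nil, map_one, Subsingleton.elim v Fin.elim0]
    rfl
  | succ k ih =>
    rw [List.ofFn_succ', List.concat_eq_append, FreeMonoid.ofList_append, map_mul, ih,
      FreeMonoid.ofList_singleton, word_of, incl, single_tmul_mul_single_tmul]
    congr 2
    rw [Fin.append_right_eq_snoc]
    exact Fin.snoc_init_self v

lemma dense_span_word :
    Dense (Submodule.span ℂ (Set.range (word V)) : Set (BanachTensorAlgebra V)) := by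
  set W := Submodule.span ℂ (Set.range (word V)) with hW
  refine dense_of_single_mem fun k x => ?_
  have hc : Continuous (lp.single (E := fun k : ℕ => ProjTensorPower V k) 1 k) :=
    (lp.isometry_single k).continuous
  induction x using UniformSpace.Completion.induction_on with
  | hp => exact W.isClosed_topologicalClosure.preimage hc
  | ih x =>
    refine W.le_topologicalClosure ?_
    have hx : x ∈ Submodule.span ℂ
        (Set.range (PiTensorProduct.tprod ℂ (s := fun _ : Fin k => V))) := by
      rw [PiTensorProduct.span_tprod_eq_top]; trivial
    induction hx using Submodule.span_induction with
    | mem x hx =>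
      obtain ⟨v, rfl⟩ := hx
      exact Submodule.subset_span ⟨_, word_ofFn v⟩
    | zero =>
      rw [UniformSpace.Completion.coe_zero, lp.single_zero]
      exact W.zero_mem
    | add x y _ _ hx hy =>
      rw [UniformSpace.Completion.coe_add, lp.single_add]
      exact add_mem hx hy
    | smul c x _ hx =>
      rw [UniformSpace.Completion.coe_smul, lp.single_smul]
      exact W.smul_mem c hx

/-- A letter-linear function `g` of words with `‖g (v₁ ⋯ vₖ)‖ ≤ C ‖v₁‖ ⋯ ‖vₖ‖` extends to a bounded
linear map on the tensor algebra. -/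
theorem exists_clm_of_letterLinear {F : Type*} [NormedAddCommGroup F] [NormedSpace ℂ F]
    [CompleteSpace F] {g : FreeMonoid V → F} (hg : IsLetterLinear g) {C : ℝ} (hC : 0 ≤ C)
    (hb : ∀ w, ‖g w‖ ≤ C * wordNorm V w) :
    ∃ L : BanachTensorAlgebra V →L[ℂ] F, ‖L‖ ≤ C ∧ ∀ w, L (word V w) = g w := by
  have hb' (k : ℕ) (v : Fin k → V) : ‖hg.toMultilinearMap k v‖ ≤ C * ∏ i, ‖v i‖ :=
    (hb _).trans_eq (by rw [wordNorm_ofFn])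
  let f (k : ℕ) : ContinuousMultilinearMap ℂ (fun _ : Fin k => V) F :=
    (hg.toMultilinearMap k).mkContinuous C (hb' k)
  have hf (k : ℕ) : ‖f k‖ ≤ C := MultilinearMap.mkContinuous_norm_le _ hC _
  let L (k : ℕ) : ProjTensorPower V k →L[ℂ] F :=
    (PiTensorProduct.liftIsometry ℂ (fun _ : Fin k => V) F (f k)).fromCompletion
  have hL (k : ℕ) (x : ProjTensorPower V k) : ‖L k x‖ ≤ C * ‖x‖ := by
    induction x using UniformSpace.Completion.induction_on with
    | hp => exact isClosed_le (by fun_prop) (by fun_prop)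
    | ih x =>
      rw [ContinuousLinearMap.fromCompletion_apply_coe, UniformSpace.Completion.norm_coe,
        PiTensorProduct.liftIsometry_apply_apply]
      exact (PiTensorProduct.norm_eval_le_projectiveSeminorm (f k) x).trans (by gcongr; exact hf k)
  obtain ⟨Φ, hΦ, hΦs⟩ := exists_clm_of_norm_le L hC hL
  refine ⟨Φ, hΦ, fun w => ?_⟩
  obtain ⟨k, v, rfl⟩ : ∃ (k : ℕ) (v : Fin k → V), w = .ofList (List.ofFn v) :=
    ⟨w.toList.length, w.toList.get, by rw [List.ofFn_get]; rfl⟩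
  rw [word_ofFn, hΦs, ProjTensorPower.tmul, ContinuousLinearMap.fromCompletion_apply_coe,
    PiTensorProduct.liftIsometry_apply_apply, PiTensorProduct.lift.tprod]
  rfl

/-- Multilinear version of `exists_clm_of_letterLinear`, by currying: for each first word the
remaining variables give a bounded multilinear functional, and this depends on the first word in a
letter-linear way. -/
theorem exists_multilinear_of_letterLinear {n : ℕ} {f : (Fin n → FreeMonoid V) → ℂ}
    (hf : ∀ x i, IsLetterLinear fun w => f (Function.update x i w)) {C : ℝ} (hC : 0 ≤ C)
    (hb : ∀ x, ‖f x‖ ≤ C * ∏ i, wordNorm V (x i)) :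
    ∃ T : ContinuousMultilinearMap ℂ (fun _ : Fin n => BanachTensorAlgebra V) ℂ,
      ‖T‖ ≤ C ∧ ∀ x, T (word V ∘ x) = f x := by
  induction n generalizing C with
  | zero =>
    refine ⟨ContinuousMultilinearMap.constOfIsEmpty ℂ _ (f Fin.elim0), ?_, fun x => ?_⟩
    · rw [ContinuousMultilinearMap.norm_constOfIsEmpty]
      simpa using hb Fin.elim0
    · rw [ContinuousMultilinearMap.constOfIsEmpty_apply, Subsingleton.elim x Fin.elim0]
  | succ n ih =>
    have hT (w : FreeMonoid V) := ih (f := fun y => f (Fin.cons w y)) (C := C * wordNorm V w)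
      (fun y i => by
        have := hf (Fin.cons w y) i.succ
        simpa only [← Fin.cons_update] using this)
      (mul_nonneg hC (wordNorm_nonneg w))
      (fun y => (hb _).trans_eq (by rw [Fin.prod_univ_succ, mul_assoc]; simp))
    choose T hTn hT using hT
    have hlin : IsLetterLinear T := fun u w c x y => by
      refine continuousMultilinearMap_ext_of_dense_span dense_span_word fun a ha => ?_
      choose z hz using ha
      obtain rfl : word V ∘ z = a := funext hz
      have := hf (Fin.cons 1 z) 0 u w c x y
      simp only [Fin.update_cons_zero] at this
      simpa [hT] using this
    obtain ⟨L, hL, hLw⟩ := exists_clm_of_letterLinear hlin hC hTn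
    refine ⟨L.uncurryLeft, ?_, fun x => ?_⟩
    · rwa [ContinuousLinearMap.uncurryLeft_norm]
    · rw [ContinuousLinearMap.uncurryLeft_apply]
      have : Fin.tail (word V ∘ x) = word V ∘ Fin.tail x := rfl
      rw [this, Function.comp_apply, hLw, hT, Fin.cons_self_tail]

end BanachTensorAlgebra

/-! ### The homotopy preserves boundedness and linearity in letters -/

section HomotopyBounds

variable {V : Type*} [NormedAddCommGroup V] [NormedSpace ℂ V] {n : ℕ}

lemma norm_cutHomotopy_le {f : (Fin (n + 2) → FreeMonoid V) → ℂ} {C : ℝ}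
    (hb : ∀ x, ‖f x‖ ≤ C * ∏ i, wordNorm V (x i)) (hC : 0 ≤ C) (x : Fin (n + 1) → FreeMonoid V) :
    ‖cutHomotopy f x‖ ≤ C * ∏ i, wordNorm V (x i) := by
  have hP : 0 ≤ C * ∏ i, wordNorm V (x i) :=
    mul_nonneg hC (Finset.prod_nonneg fun i _ => wordNorm_nonneg _)
  have hcut : ‖cutSum f x‖ ≤ totalLength x * (C * ∏ i, wordNorm V (x i)) := by
    have hi (i : Fin (n + 1)) : ‖(-1 : ℂ) ^ (i : ℕ) *
        splitSum (fun u v => f (splitEntry i u v x)) (x i)‖ ≤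
          (x i).length * (C * ∏ i, wordNorm V (x i)) := by
      rw [norm_mul, norm_pow, norm_neg, norm_one, one_pow, one_mul]
      refine norm_splitSum_le _ _ _ fun u v h => ?_
      rw [← prod_splitEntry (wordNorm V) i u v x h]
      exact hb _
    refine (norm_sum_le_of_le _ fun i _ => hi i).trans_eq ?_
    rw [← Finset.sum_mul, totalLength]
    push_cast
    rfl
  rw [cutHomotopy, norm_mul, norm_inv, Complex.norm_natCast]
  -- A tuple without letters has the value `0`.
  by_cases hx : (totalLength x : ℝ) = 0
  · simpa [hx] using hP
  · calc (totalLength x : ℝ)⁻¹ * ‖cutSum f x‖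
        ≤ (totalLength x : ℝ)⁻¹ * (totalLength x * (C * ∏ i, wordNorm V (x i))) := by gcongr
      _ = C * ∏ i, wordNorm V (x i) := by field_simp

lemma splitSum_isLetterLinear {φ : FreeMonoid V → FreeMonoid V → ℂ}
    (h1 : ∀ v, IsLetterLinear fun u => φ u v) (h2 : ∀ u, IsLetterLinear fun v => φ u v) :
    IsLetterLinear (splitSum φ) := by
  intro p q c x y
  have hφ1 (u v : FreeMonoid V) (z : V) : φ u (v * (.of z * q)) = φ u (v * .of z * q) := by
    rw [mul_assoc]
  simp only [mul_assoc p, splitSum_mul, splitSum_of, hφ1]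
  have a1 : splitSum (fun u v => φ u (v * .of (c • x + y) * q)) p =
      c * splitSum (fun u v => φ u (v * .of x * q)) p +
        splitSum (fun u v => φ u (v * .of y * q)) p := by
    rw [← splitSum_mul_left, ← splitSum_add]
    exact splitSum_congr fun u v _ => h2 u v q c x y
  have a2 : φ (p * 1) (.of (c • x + y) * q) =
      c * φ (p * 1) (.of x * q) + φ (p * 1) (.of y * q) := by
    simpa using h2 (p * 1) 1 q c x y
  have a3 : splitSum (fun u v => φ (p * (.of (c • x + y) * u)) v) q =
      c * splitSum (fun u v => φ (p * (.of x * u)) v) q +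
        splitSum (fun u v => φ (p * (.of y * u)) v) q := by
    rw [← splitSum_mul_left, ← splitSum_add]
    refine splitSum_congr fun u v _ => ?_
    simpa only [mul_assoc, smul_eq_mul] using h1 v p u c x y
  rw [a1, a2, a3, smul_eq_mul]
  ring

lemma length_letter (p q : FreeMonoid V) (z z' : V) :
    (p * .of z * q).length = (p * .of z' * q).length := by
  simp [FreeMonoid.length_mul]

lemma totalLength_update (x : Fin n → FreeMonoid V) (k : Fin n) {w w' : FreeMonoid V}
    (h : w.length = w'.length) :
    totalLength (Function.update x k w) = totalLength (Function.update x k w') := by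
  refine Finset.sum_congr rfl fun i _ => ?_
  by_cases hi : i = k
  · subst hi; simp [h]
  · simp [hi]

lemma cutHomotopy_isLetterLinear {f : (Fin (n + 2) → FreeMonoid V) → ℂ}
    (hf : ∀ x i, IsLetterLinear fun w => f (Function.update x i w))
    (x : Fin (n + 1) → FreeMonoid V) (k : Fin (n + 1)) :
    IsLetterLinear fun w => cutHomotopy f (Function.update x k w) := by
  have hterm (i : Fin (n + 1)) : IsLetterLinear fun w =>
      splitSum (fun u v => f (splitEntry i u v (Function.update x k w)))
        (Function.update x k w i) := by
    by_cases hi : i = k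
    · subst hi
      simp only [splitEntry_update_self, Function.update_self]
      refine splitSum_isLetterLinear (fun v => ?_) fun u => ?_
      · rw [show (fun u => f (splitEntry i u v x)) =
            fun u => f (Function.update (splitEntry i 1 v x) i.castSucc u) from
          funext fun u => congrArg f (splitEntry_eq_update_left i u 1 v x)]
        exact hf _ _
      · rw [show (fun v => f (splitEntry i u v x)) =
            fun v => f (Function.update (splitEntry i u 1 x) i.succ v) from
          funext fun v => congrArg f (splitEntry_eq_update_right i u v 1 x)]
        exact hf _ _
    · simp only [splitEntry_update_of_ne i k hi, Function.update_of_ne hi]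
      intro p q c y z
      rw [smul_eq_mul, ← splitSum_mul_left, ← splitSum_add]
      exact splitSum_congr fun u v _ => hf _ _ p q c y z
  intro p q c y z
  have hcut : cutSum f (Function.update x k (p * .of (c • y + z) * q)) =
      c * cutSum f (Function.update x k (p * .of y * q)) +
        cutSum f (Function.update x k (p * .of z * q)) := by
    rw [cutSum, cutSum, cutSum, Finset.mul_sum, ← Finset.sum_add_distrib]
    refine Finset.sum_congr rfl fun i _ => ?_
    have := hterm i p q c y z
    simp only [smul_eq_mul] at this
    rw [this]
    ring
  simp only [cutHomotopy]
  rw [totalLength_update x k (length_letter p q (c • y + z) y),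
    totalLength_update x k (length_letter p q z y), hcut, smul_eq_mul]
  ring

lemma isLetterLinear_lift {B : Type*} [NormedRing B] [NormedAlgebra ℂ B]
    (φ : V →ₗ[ℂ] B) : IsLetterLinear (FreeMonoid.lift φ) := by
  intro p q c x y
  simp [mul_add, add_mul]

lemma norm_lift_le_wordNorm {B : Type*} [NormedRing B] (h1 : ‖(1 : B)‖ ≤ 1) (φ : V → B)
    (hφ : ∀ v, ‖φ v‖ ≤ ‖v‖) (w : FreeMonoid V) : ‖FreeMonoid.lift φ w‖ ≤ wordNorm V w := by
  induction w using FreeMonoid.inductionOn' with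
  | one => simpa using h1
  | of_mul x w ih =>
    rw [map_mul, map_mul]
    refine (norm_mul_le _ _).trans (mul_le_mul ?_ ih (norm_nonneg _) (wordNorm_nonneg _))
    simpa [wordNorm] using hφ x

end HomotopyBounds

/-! ### The universal property and the homotopy of the tensor algebra -/

namespace BanachTensorAlgebra

variable {V : Type*} [NormedAddCommGroup V] [NormedSpace ℂ V]

lemma norm_one_le : ‖(1 : BanachTensorAlgebra V)‖ ≤ 1 := by
  have : (1 : BanachTensorAlgebra V) = lp.single 1 0 (ProjTensorPower.tmul Fin.elim0) := rfl
  rw [this, lp.norm_single (by simp), ProjTensorPower.tmul, UniformSpace.Completion.norm_coe]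
  exact (PiTensorProduct.projectiveSeminorm_tprod_le _).trans_eq (by simp)

lemma norm_incl_le (v : V) : ‖incl v‖ ≤ ‖v‖ := by
  rw [incl, lp.norm_single (by simp), ProjTensorPower.tmul, UniformSpace.Completion.norm_coe]
  exact (PiTensorProduct.projectiveSeminorm_tprod_le _).trans_eq (by simp)

lemma norm_word_le (w : FreeMonoid V) : ‖word V w‖ ≤ wordNorm V w :=
  norm_lift_le_wordNorm norm_one_le incl norm_incl_le w

/-- A contraction from `V` to a Banach algebra extends to a contractive homomorphism on the tensor
algebra. -/
theorem exists_algHom {B : Type*} [NormedRing B] [NormedAlgebra ℂ B] [CompleteSpace B]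
    (h1 : ‖(1 : B)‖ ≤ 1) (φ : V →ₗ[ℂ] B) (hφ : ∀ v, ‖φ v‖ ≤ ‖v‖) :
    ∃ Φ : BanachTensorAlgebra V →ₐ[ℂ] B, (∀ a, ‖Φ a‖ ≤ ‖a‖) ∧ ∀ v, Φ (incl v) = φ v := by
  obtain ⟨L, hL, hLw⟩ := exists_clm_of_letterLinear (isLetterLinear_lift φ) zero_le_one
    (fun w => by simpa using norm_lift_le_wordNorm h1 φ hφ w)
  obtain ⟨Φ, hΦ⟩ := exists_algHom_of_clm dense_span_word L
    (by simpa using hLw 1) (fun u v => by rw [hLw, hLw, hLw, map_mul])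
  refine ⟨Φ, fun a => ?_, fun v => ?_⟩
  · rw [hΦ]
    exact (L.le_of_opNorm_le hL a).trans_eq (one_mul _)
  · rw [hΦ, ← word_of, hLw]
    simp

/-- The inclusion `BanachTensorAlgebra.incl` as a linear map. -/
def inclL (V : Type*) [NormedAddCommGroup V] [NormedSpace ℂ V] : V →ₗ[ℂ] BanachTensorAlgebra V :=
  lp.lsingle 1 1 ∘ₗ UniformSpace.Completion.toComplₗᵢ.toLinearMap ∘ₗ
    (PiTensorProduct.tprod ℂ (s := fun _ : Fin 1 => V)).toLinearMap 0 0

lemma inclL_apply (v : V) : inclL V v = incl v := by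
  have ht : (PiTensorProduct.tprod ℂ (s := fun _ : Fin 1 => V)).toLinearMap 0 0 v =
      (PiTensorProduct.tprod ℂ ![v] : ⨂[ℂ]^1 V) := by
    rw [MultilinearMap.toLinearMap_apply]
    congr 1
    funext i
    rw [Subsingleton.elim i 0]
    simp
  rw [incl, ProjTensorPower.tmul, ← ht]
  rfl

lemma isLetterLinear_cochain {n : ℕ} (T : SimplicialCochain (BanachTensorAlgebra V) n)
    (x : Fin (n + 1) → FreeMonoid V) (i : Fin (n + 1)) :
    IsLetterLinear fun w => T (word V ∘ Function.update x i w) := by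
  have h (w : FreeMonoid V) : T (word V ∘ Function.update x i w) =
      T.toMap.toContinuousLinearMap (word V ∘ x) i (word V w) := by
    rw [Function.comp_update]
    rfl
  intro p q c y z
  simp only [h, map_mul, word_of, ← inclL_apply, map_add, map_smul, mul_add, add_mul, mul_smul_comm,
    smul_mul_assoc]

theorem hasWordHomotopy_word : HasWordHomotopy (word V) := by
  refine ⟨dense_span_word, fun n T => ?_, ?_⟩
  · obtain ⟨S, -, hS⟩ := exists_multilinear_of_letterLinear
      (cutHomotopy_isLetterLinear (f := fun y => T (word V ∘ y)) (isLetterLinear_cochain T))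
      (norm_nonneg T)
      (norm_cutHomotopy_le (fun x => (T.toMap.le_opNorm _).trans (mul_le_mul_of_nonneg_left
        (Finset.prod_le_prod (fun _ _ => norm_nonneg _) fun i _ => norm_word_le (x i))
        (norm_nonneg T))) (norm_nonneg T))
    exact ⟨S, hS⟩
  · obtain ⟨ε, hε, -⟩ := exists_algHom (V := V) (B := ℂ) (by simp) 0 (by simp)
    exact ⟨ε, AddMonoidHomClass.continuous_of_bound ε 1 fun a => by simpa using hε a⟩

end BanachTensorAlgebra

/-! ### The universal property of the convolution algebra of a monoid -/

namespace L1Algebra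

variable {S : Type*} [Monoid S] [DecidableEq S]

/-- The canonical homomorphism `s ↦ δ_s`. -/
def delta (S : Type*) [Monoid S] [DecidableEq S] : S →* L1Algebra S where
  toFun s := lp.single 1 s 1
  map_one' := rfl
  map_mul' s t := by rw [single_mul_single, one_mul]

lemma dense_span_delta : Dense (Submodule.span ℂ (Set.range (delta S)) : Set (L1Algebra S)) := by
  refine dense_of_single_mem fun s c => Submodule.le_topologicalClosure _ ?_
  have : (lp.single 1 s c : L1Algebra S) = c • delta S s := by
    change _ = c • lp.single 1 s 1
    rw [← lp.single_smul, smul_eq_mul, mul_one]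
  rw [this]
  exact Submodule.smul_mem _ _ (Submodule.subset_span ⟨s, rfl⟩)

lemma norm_delta (s : S) : ‖delta S s‖ = 1 := by
  change ‖(lp.single 1 s 1 : L1Algebra S)‖ = 1
  rw [lp.norm_single (by simp), norm_one]

/-- A homomorphism from `S` to the unit ball of a Banach algebra extends to a contractive
homomorphism on `ℓ¹(S)`. -/
theorem exists_algHom {B : Type*} [NormedRing B] [NormedAlgebra ℂ B] [CompleteSpace B]
    (G : S →* B) (hG : ∀ s, ‖G s‖ ≤ 1) :
    ∃ Φ : L1Algebra S →ₐ[ℂ] B, (∀ a, ‖Φ a‖ ≤ ‖a‖) ∧ ∀ s, Φ (delta S s) = G s := by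
  have hb (s : S) (c : ℂ) : ‖ContinuousLinearMap.toSpanSingleton ℂ (G s) c‖ ≤ 1 * ‖c‖ := by
    rw [ContinuousLinearMap.toSpanSingleton_apply, norm_smul, one_mul]
    exact mul_le_of_le_one_right (norm_nonneg c) (hG s)
  obtain ⟨L, hL, hLw⟩ : ∃ L : L1Algebra S →L[ℂ] B, ‖L‖ ≤ 1 ∧ ∀ s c,
      L (lp.single 1 s c) = ContinuousLinearMap.toSpanSingleton ℂ (G s) c :=
    exists_clm_of_norm_le (E := fun _ : S => ℂ) _ zero_le_one hb
  have hLd (s : S) : L (delta S s) = G s := by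
    refine (hLw s 1).trans ?_
    simp
  obtain ⟨Φ, hΦ⟩ := exists_algHom_of_clm (A := L1Algebra S) (e := delta S) dense_span_delta L
    (by rw [← map_one (delta S), hLd, map_one]) (fun u v => by rw [hLd, hLd, hLd, map_mul])
  refine ⟨Φ, fun a => ?_, fun s => by rw [hΦ, hLd]⟩
  rw [hΦ]
  exact (L.le_of_opNorm_le hL a).trans_eq (one_mul _)

end L1Algebra

/-! ### The tensor algebra of a finite-dimensional `ℓ¹`-space -/

/-- The universal properties of the two algebras give contractive homomorphisms in both directions.
They are inverse to each other since they are so on generators, hence isometric. -/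
theorem exists_isometric_algEquiv (m : ℕ) :
    ∃ Φ : BanachTensorAlgebra (PiLp 1 (fun _ : Fin m => ℂ)) ≃ₐ[ℂ] L1Algebra (FreeMonoid (Fin m)),
      Isometry Φ ∧
      ∀ j : Fin m, Φ (BanachTensorAlgebra.incl (WithLp.toLp 1 (Pi.single j 1))) =
        lp.single 1 (FreeMonoid.of j) 1 := by
  let e (j : Fin m) : PiLp 1 (fun _ : Fin m => ℂ) := WithLp.toLp 1 (Pi.single j 1)
  let φ : PiLp 1 (fun _ : Fin m => ℂ) →ₗ[ℂ] L1Algebra (FreeMonoid (Fin m)) :=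
    { toFun := fun v => ∑ j, v j • L1Algebra.delta _ (FreeMonoid.of j)
      map_add' := fun v w => by simp [add_smul, Finset.sum_add_distrib]
      map_smul' := fun c v => by simp [Finset.smul_sum, mul_smul] }
  have hφ (v) : ‖φ v‖ ≤ ‖v‖ := by
    rw [PiLp.norm_eq_of_L1]
    change ‖∑ j, v j • L1Algebra.delta _ (FreeMonoid.of j)‖ ≤ _
    refine norm_sum_le_of_le _ fun j _ => ?_
    rw [norm_smul, L1Algebra.norm_delta, mul_one]
  have hφe (j : Fin m) : φ (e j) = L1Algebra.delta _ (FreeMonoid.of j) := by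
    change ∑ k, e j k • _ = _
    rw [Finset.sum_eq_single j]
    · simp [e]
    · intro k _ hk
      simp [e, hk]
    · simp
  have he (j : Fin m) : ‖e j‖ ≤ 1 := by
    rw [PiLp.norm_eq_of_L1, Finset.sum_eq_single j]
    · simp [e]
    · intro k _ hk
      simp [e, hk]
    · simp
  obtain ⟨P, hP, hPe⟩ := BanachTensorAlgebra.exists_algHom (L1Algebra.norm_delta 1).le φ hφ
  let G : FreeMonoid (Fin m) →* BanachTensorAlgebra (PiLp 1 (fun _ : Fin m => ℂ)) :=
    FreeMonoid.lift fun j => BanachTensorAlgebra.incl (e j)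
  have hG (s) : ‖G s‖ ≤ 1 := by
    induction s using FreeMonoid.inductionOn' with
    | one => rw [map_one]; exact BanachTensorAlgebra.norm_one_le
    | of_mul x w ih =>
      rw [map_mul]
      refine (norm_mul_le _ _).trans (mul_le_one₀ ?_ (norm_nonneg _) ih)
      simpa [G] using (BanachTensorAlgebra.norm_incl_le (e x)).trans (he x)
  obtain ⟨Q, hQ, hQe⟩ := L1Algebra.exists_algHom G hG
  have hPG (s) : P (G s) = L1Algebra.delta _ s := by
    refine DFunLike.congr_fun (f := (P : _ →* L1Algebra (FreeMonoid (Fin m))).comp G)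
      (FreeMonoid.hom_eq fun j => ?_) s
    simp [G, hPe, hφe]
  have hPc : Continuous P := AddMonoidHomClass.continuous_of_bound P 1 (by simpa using hP)
  have hQc : Continuous Q := AddMonoidHomClass.continuous_of_bound Q 1 (by simpa using hQ)
  have hPQ (a) : P (Q a) = a := by
    refine DFunLike.congr_fun (ContinuousLinearMap.ext_on
      (f := (⟨(P.comp Q).toLinearMap, hPc.comp hQc⟩ : L1Algebra (FreeMonoid (Fin m)) →L[ℂ] _))
      (g := .id ℂ _) L1Algebra.dense_span_delta ?_) a
    rintro _ ⟨s, rfl⟩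
    change P (Q _) = _
    rw [hQe, hPG]
    rfl
  have hincl (v : PiLp 1 (fun _ : Fin m => ℂ)) :
      Q (P (BanachTensorAlgebra.incl v)) = BanachTensorAlgebra.incl v := by
    have hv : v = ∑ j, v j • e j := by
      ext k
      simp [e, Pi.single_apply]
    conv_rhs => rw [hv, ← BanachTensorAlgebra.inclL_apply, map_sum]
    rw [hPe]
    change Q (∑ j, v j • L1Algebra.delta _ (FreeMonoid.of j)) = _
    simp [hQe, G, BanachTensorAlgebra.inclL_apply]
  have hQP (a) : Q (P a) = a := by
    refine DFunLike.congr_fun (ContinuousLinearMap.ext_on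
      (f := (⟨(Q.comp P).toLinearMap, hQc.comp hPc⟩ : BanachTensorAlgebra _ →L[ℂ] _))
      (g := .id ℂ _) BanachTensorAlgebra.dense_span_word ?_) a
    rintro _ ⟨w, rfl⟩
    change Q (P (BanachTensorAlgebra.word _ w)) = BanachTensorAlgebra.word _ w
    induction w using FreeMonoid.inductionOn' with
    | one => simp
    | of_mul v w ih => rw [map_mul, map_mul, map_mul, ih, BanachTensorAlgebra.word_of, hincl]
  refine ⟨AlgEquiv.ofAlgHom P Q (AlgHom.ext hPQ) (AlgHom.ext hQP),
    AddMonoidHomClass.isometry_of_norm _ fun a => le_antisymm (hP a) ?_, fun j => ?_⟩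
  · conv_lhs => rw [← hQP a]
    exact hQ _
  · exact (hPe (e j)).trans (hφe j)

end

theorem mainTheorem3
    (V : Type*) [NormedAddCommGroup V] [NormedSpace ℂ V] [CompleteSpace V] (m : ℕ) :
    (∀ n : ℕ, Odd n → Subsingleton (CyclicCohomology (BanachTensorAlgebra V) n)) ∧
    (∀ n : ℕ, Even n → 2 ≤ n →
      Nonempty (CyclicCohomology (BanachTensorAlgebra V) n ≃L[ℂ] ℂ)) ∧
    (∃ Φ : BanachTensorAlgebra (PiLp 1 (fun _ : Fin m => ℂ)) ≃ₐ[ℂ] L1Algebra (FreeMonoid (Fin m)),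
      Isometry Φ ∧
      ∀ j : Fin m, Φ (BanachTensorAlgebra.incl (WithLp.toLp 1 (Pi.single j 1))) =
        lp.single 1 (FreeMonoid.of j) 1) ∧
    (∀ n : ℕ, Odd n → Subsingleton (CyclicCohomology (L1Algebra (FreeMonoid (Fin m))) n)) ∧
    (∀ n : ℕ, Even n → 2 ≤ n →
      Nonempty (CyclicCohomology (L1Algebra (FreeMonoid (Fin m))) n ≃L[ℂ] ℂ)) := by
  obtain ⟨Φ, hΦ, hΦe⟩ := exists_isometric_algEquiv m
  have hV := BanachTensorAlgebra.hasWordHomotopy_word (V := V)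
  have hF := BanachTensorAlgebra.hasWordHomotopy_word.of_algEquiv Φ hΦ
  exact ⟨fun n hn => hV.subsingleton_cyclicCohomology hn,
    fun n hn h2 => hV.nonempty_cyclicCohomology_equiv hn h2, ⟨Φ, hΦ, hΦe⟩,
    fun n hn => hF.subsingleton_cyclicCohomology hn,
    fun n hn h2 => hF.nonempty_cyclicCohomology_equiv hn h2⟩
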